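/- Graphs are finite, simple and undirected. For a graph $G=(V,E)$, $\kappa(G)$ denotes its vertex connectivity: the least number of vertices whose removal leaves a graph that is disconnected or has at most one vertex. A monitor placement for $G$ is a pair $(S,T)$ of disjoint non-empty sets of vertices; $\mathbb{P}$ is the set of all simple paths of $G$ with one end-point in $S$ and the other one in $T$, and for $U\subseteq V$, $\mathbb{P}(U)$ is the set of the paths in $\mathbb{P}$ that pass through some vertex of $U$. A set $N$ of vertices is $k$-identifiable if $\mathbb{P}(U)\neq\mathbb{P}(W)$ for any two distinct $U,W\subseteq N$ with $|U|,|W|\le k$. The maximal identifiability $\mu(G)=\mu(G,S,T)$ is the largest $k\le |N|$ such that $N$ is $k$-identifiable, where $N$ is the set of the vertices that lie on at least one path of $\mathbb{P}$. Two distinct points of the cube $\{1,\dots,n\}^d$ share a line of sight if they differ in exactly one coordinate. A graph $G=(V,E)$ is a $d$-dimensional Line-of-Sight (LoS) network of size $n$ with range parameter $\omega$ if there is an injective map $f:V\to\{1,\dots,n\}^d$ such that $\{u,v\}\in E$ if and only if $f(u)$ and $f(v)$ share a line of sight and are at distance less than $\omega$. For $\omega>2$ the augmented hypergrid $\mathcal{H}=\mathcal{H}_{n,d,\omega}$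 is the LoS network on all $n^d$ points of the cube. A monitor placement $(S,T)$ for $\mathcal{H}$ is called canonical if $|S|=|T|=d\omega-1$, every point of $S$ has some coordinate equal to $1$, and every point of $T$ has some coordinate equal to $n$. **Theorem 1.** Let $d$ and $\omega$ be positive integers. 1. Let $n\ge 2$ and $\omega>2$, and let $\mathcal{H}=\mathcal{H}_{n,d,\omega}$. Then $\mu(\mathcal{H})\le\kappa(\mathcal{H})$ for every monitor placement, and $\mu(\mathcal{H})\ge\kappa(\mathcal{H})-1$ for every canonical monitor placement. Moreover, if $d\ge 2$ or $n\ge 2\omega-3$, there is a monitor placement for which $\kappa(\mathcal{H})-1\le\mu(\mathcal{H})\le\kappa(\mathcal{H})$. 2. Let $G=(V,E)$ be an arbitrary $d$-dimensional LoS network with range parameter $\omega$, of any size $n$, with $|V|\ge 2$. Then $\kappa(G)\le 2d(\omega-1)$, and if $|V|\ge 3\kappa(G)$ (in particular, whenever $|V|\ge 6d(\omega-1)$), there is a monitor placement for $G$ such that $\kappa(G)-2\le\mu(G)\le\kappa(G)$. -/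

import Mathlib

namespace Tomography

section Graphs

variable {V : Type*} [Fintype V]

/-- The vertex-connectivity `κ(G)`: the least size of a set `K` of vertices whose removal leaves
a graph that is disconnected or (the usual convention, relevant only to complete graphs) has at
most one vertex. -/
noncomputable def vertexConnectivity (G : SimpleGraph V) : ℕ :=
  sInf {k : ℕ | ∃ K : Finset V, K.card = k ∧
    (¬ (G.induce ((K : Set V)ᶜ)).Preconnected ∨ ((K : Set V)ᶜ).Subsingleton)}

/-- A monitor placement: two disjoint non-empty sets of vertices. -/
def IsMonitorPlacement (S T : Finset V) : Prop :=
  S.Nonempty ∧ T.Nonempty ∧ Disjoint S T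

/-- The family of all simple paths of `G` with one end-point in `S` and the other one in `T`
(as the graph is undirected, every such path is listed from its end-point in `S`). -/
def monitorPaths (G : SimpleGraph V) (S T : Finset V) : Set (Σ s t : V, G.Walk s t) :=
  {p | p.1 ∈ S ∧ p.2.1 ∈ T ∧ p.2.2.IsPath}

/-- The monitoring paths that pass through at least one vertex of `U`. -/
def pathsThrough (G : SimpleGraph V) (S T U : Finset V) : Set (Σ s t : V, G.Walk s t) :=
  {p | p ∈ monitorPaths G S T ∧ ∃ u ∈ U, u ∈ p.2.2.support}

/-- `U` and `W` are separable if some monitoring path meets exactly one of them. -/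
def Separable (G : SimpleGraph V) (S T U W : Finset V) : Prop :=
  (symmDiff (pathsThrough G S T U) (pathsThrough G S T W)).Nonempty

/-- `N` is `k`-identifiable if any two distinct subsets of `N` of size at most `k` are
separable. -/
def IsIdentifiable (G : SimpleGraph V) (S T : Finset V) (N : Set V) (k : ℕ) : Prop :=
  ∀ U W : Finset V, (U : Set V) ⊆ N → (W : Set V) ⊆ N → U ≠ W → U.card ≤ k → W.card ≤ k →
    Separable G S T U W

/-- The vertices that lie on at least one monitoring path. -/
def usedVertices (G : SimpleGraph V) (S T : Finset V) : Set V :=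
  {v | ∃ p ∈ monitorPaths G S T, v ∈ p.2.2.support}

/-- The maximal identifiability `μ(G)` with respect to `(S, T)`: the largest `k` such that the set
`N` of used vertices is `k`-identifiable. Here `k` ranges up to `|N|`; for a monitor placement this
matters only if there is no monitoring path at all, since a non-empty `N` is never
`|N|`-identifiable (compare `N` with `N` minus a vertex). -/
noncomputable def maxIdentifiability (G : SimpleGraph V) (S T : Finset V) : ℕ :=
  sSup {k : ℕ | k ≤ (usedVertices G S T).ncard ∧ IsIdentifiable G S T (usedVertices G S T) k}

end Graphs

/-- Two points of the cube share a line of sight if they differ in exactly one coordinate, and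
they are in range if that coordinate differs by less than `ω`. The cube `{1, …, n}ᵈ` is written
`Fin d → Fin n`, with coordinates shifted to `0, …, n - 1`. -/
def InSight {d n : ℕ} (ω : ℕ) (x y : Fin d → Fin n) : Prop :=
  ∃ i, x i ≠ y i ∧ (∀ j, j ≠ i → x j = y j) ∧ |((x i : ℕ) : ℤ) - ((y i : ℕ) : ℤ)| < (ω : ℤ)

/-- The Line-of-Sight network on all `n ^ d` points of the cube with range parameter `ω`; for
`2 < ω` this is the augmented hypergrid `H_{n,d,ω}`. -/
def hypergrid (n d ω : ℕ) : SimpleGraph (Fin d → Fin n) where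
  Adj x y := InSight ω x y
  symm := ⟨by
    rintro x y ⟨i, h, h', hω⟩
    exact ⟨i, h.symm, fun j hj => (h' j hj).symm, by rwa [abs_sub_comm]⟩⟩
  loopless := ⟨by
    rintro x ⟨i, h, -⟩
    exact h rfl⟩

/-- `G` is a Line-of-Sight network of size `n`, dimension `d` and range parameter `ω`: its vertices
embed in the cube so that adjacency is exactly being in sight and in range. -/
def IsLoSNetwork {V : Type*} (G : SimpleGraph V) (n d ω : ℕ) : Prop :=
  ∃ f : V → (Fin d → Fin n), Function.Injective f ∧ ∀ u v, G.Adj u v ↔ InSight ω (f u) (f v)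

/-- A canonical monitor placement of `H_{n,d,ω}`: `d * ω - 1` monitors of each kind, those in `S`
on the borders where some coordinate is least (north and west, if `d = 2`), those in `T` on the
borders where some coordinate is greatest (south and east). -/
def IsCanonicalPlacement (n d ω : ℕ) (S T : Finset (Fin d → Fin n)) : Prop :=
  IsMonitorPlacement S T ∧ S.card = d * ω - 1 ∧ T.card = d * ω - 1 ∧
    (∀ x ∈ S, ∃ i, (x i : ℕ) = 0) ∧ (∀ x ∈ T, ∃ i, (x i : ℕ) + 1 = n)

end Tomography

/-!
Write `κ` for the vertex connectivity and `m = min n ω - 1`.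

**The connectivity of the hypergrid is `d * m`.** A corner has `d * m` neighbours. For the lower
bound, suppose that `K` splits the rest of the cube into `C` and `D` without edges between them, and
cut the cube into the layers perpendicular to an axis. A layer that meets both `C` and `D` contains
`(d - 1) * m` elements of `K` by induction on `d`, and a line that does so contains `m` of them
(`exists_gap`). Distinguishing whether at least two layers, exactly one layer, or no layer meets both
sides gives `d * m ≤ |K|`, and moreover, if `2 ≤ d`, that equality forces `C` or `D` to be a single
point (`IsLayeredSeparation.card_separator_ge`, `IsSeparation.card_hypergrid`).

**Upper bounds on the identifiability.** If every monitoring path through a used vertex `v` meets a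
set `K` that does not contain `v`, then `K` and `K ∪ {v}` (restricted to used vertices) are not
separable, so the maximal identifiability is at most `|K|` (`maxIdentifiability_le_card`). In the
hypergrid this is applied to a corner and its neighbours; the corner is used because the hypergrid is
2-connected (or has only two vertices).

**Lower bound for canonical placements.** Let `|U| < κ` and `w ∉ U`. By the fan form of Menger's
theorem for two paths (`exists_isPath_through`), a monitoring path through `w` avoids `U`, unless `U`
and a single further vertex separate `w` from all monitors. There are so many monitors that the
isoperimetric result then makes `w` the single point on its side, so that `U` consists of all but one
of the neighbours of `w`, which has degree `d * m` (`separable_or_eq_visible`). If `U` and `W` were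
not separable, this would hold for `U` and every `w ∈ W \ U`, and for `W` and every `u ∈ U \ W`. Then
some `p ∈ W \ U` is not on the line through `u` and `w`, and all of `U` would be adjacent to both `w`
and `p`, which have at most two common neighbours. So `d * m ≤ 3`, in which case the cube is too small
for a canonical placement.

**Existence of placements.** If all vertices are monitors, then any failure of `κ - 1` vertices can
be localised as soon as there are `κ` monitors of one kind and `κ - 1` of the other
(`vertexConnectivity_le_maxIdentifiability_add_one`). In the hypergrid any such partition will do. In
a general graph with at least `3 * κ` vertices, one takes a minimum separator `K` with sides `C` and
`D`, where `|C| ≤ |D|`, and lets `S = D` and `T = C ∪ K`; then `K` meets all monitoring paths through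
a vertex of `C`, so that the upper bound holds as well.
-/

namespace Tomography

/-! ### Paths through a given vertex -/

section Walks

variable {V : Type*} {G : SimpleGraph V}

/-- Along any walk that reaches a set `Z`, there is a path to the first vertex of `Z` on it. -/
theorem exists_isPath_first_mem (Z : Set V) {y z : V} (q : G.Walk y z) (hz : z ∈ Z) :
    ∃ z' ∈ Z, ∃ r : G.Walk y z', r.IsPath ∧ (∀ v ∈ r.support, v ∈ q.support) ∧
      ∀ v ∈ r.support, v ∈ Z → v = z' := by
  classical
  suffices h : ∃ z' ∈ Z, ∃ r : G.Walk y z', (∀ v ∈ r.support, v ∈ q.support) ∧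
      ∀ v ∈ r.support, v ∈ Z → v = z' by
    obtain ⟨z', hz', r, h1, h2⟩ := h
    exact ⟨z', hz', r.bypass, r.bypass_isPath,
      fun v hv => h1 v (r.support_bypass_subset_support hv),
      fun v hv => h2 v (r.support_bypass_subset_support hv)⟩
  induction q with
  | nil => exact ⟨_, hz, .nil, by simp, by simp⟩
  | @cons u v w h q ih =>
    by_cases hu : u ∈ Z
    · exact ⟨u, hu, .nil, by simp, by simp⟩
    · obtain ⟨z', hz', r, h1, h2⟩ := ih hz
      refine ⟨z', hz', .cons h r, ?_, ?_⟩
      · intro x hx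
        rw [SimpleGraph.Walk.support_cons, List.mem_cons] at hx ⊢
        exact hx.imp_right (h1 x)
      · intro x hx hxZ
        rw [SimpleGraph.Walk.support_cons, List.mem_cons] at hx
        rcases hx with rfl | hx
        · exact absurd hxZ hu
        · exact h2 x hx hxZ

theorem isPath_append_cons {a p y b : V} {P : G.Walk a p} {R : G.Walk y b} (hP : P.IsPath)
    (hR : R.IsPath) (h : G.Adj p y) (hd : ∀ v ∈ P.support, v ∉ R.support) :
    (P.append (.cons h R)).IsPath := by
  rw [SimpleGraph.Walk.isPath_def, SimpleGraph.Walk.support_append,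
    SimpleGraph.Walk.support_cons, List.tail_cons, List.nodup_append']
  exact ⟨hP.support_nodup, hR.support_nodup, fun v hv hv' => hd v hv hv'⟩

/-- A path can be rerouted through a vertex `y` adjacent to one of its vertices `p`, by means of a
path from `y` that leads back to a later vertex of it. -/
theorem exists_isPath_reroute {a b p y z : V} {P : G.Walk a p} {Q : G.Walk p b}
    (hPQ : (P.append Q).IsPath) (h : G.Adj p y) {R : G.Walk y z} (hR : R.IsPath)
    (hz : z ∈ Q.support) (hp : p ∉ R.support)
    (hd : ∀ v ∈ R.support, v ∈ (P.append Q).support → v = z) :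
    ∃ q : G.Walk a b, q.IsPath ∧ y ∈ q.support := by
  classical
  obtain ⟨Q₁, Q₂, rfl⟩ := SimpleGraph.Walk.mem_support_iff_exists_append.1 hz
  have hP := hPQ.of_append_left
  have hQ := hPQ.of_append_right
  have hQ₂ := hQ.of_append_right
  have hzp : z ≠ p := fun e => hp (e ▸ R.end_mem_support)
  have hPQd : ∀ v ∈ P.support, v ∈ (Q₁.append Q₂).support → v = p := by
    intro v hv hv'
    by_contra hne
    have := hPQ.support_nodup
    rw [SimpleGraph.Walk.support_append, List.nodup_append'] at this
    rw [← SimpleGraph.Walk.cons_tail_support, List.mem_cons] at hv'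
    exact this.2.2 hv (hv'.resolve_left hne)
  have hRQ : (R.append Q₂).IsPath := by
    rw [SimpleGraph.Walk.isPath_def, SimpleGraph.Walk.support_append, List.nodup_append']
    refine ⟨hR.support_nodup, hQ₂.support_nodup.tail, fun v hv hv' => ?_⟩
    have hvz := hd v hv (by
      simp only [SimpleGraph.Walk.mem_support_append_iff]
      exact Or.inr (Or.inr (List.mem_of_mem_tail hv')))
    subst hvz
    have := hQ₂.support_nodup
    rw [← SimpleGraph.Walk.cons_tail_support, List.nodup_cons] at this
    exact this.1 hv'
  refine ⟨P.append (.cons h (R.append Q₂)), isPath_append_cons hP hRQ h ?_, by simp⟩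
  intro v hv hv'
  rw [SimpleGraph.Walk.mem_support_append_iff] at hv'
  rcases hv' with hv' | hv'
  · have hvz := hd v hv' (by simp [hv])
    subst hvz
    exact hzp (hPQd _ hv hz)
  · have hvp := hPQd v hv (by simp [hv'])
    subst hvp
    have := hQ.support_nodup
    rw [SimpleGraph.Walk.support_append, List.nodup_append'] at this
    rw [← SimpleGraph.Walk.cons_tail_support, List.mem_cons] at hv'
    exact this.2.2 Q₁.start_mem_support (hv'.resolve_left (fun e => hzp e.symm))

/-- The case `k = 2` of Menger's theorem in fan form, for two targets of which one has to be met by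
each branch: if no vertex other than `w` separates `w` from `A ∪ B`, and both `A` and `B` can be
reached from `w`, then some path from `A` to `B` passes through `w`. -/
theorem exists_isPath_through (A B : Set V) (w : V) (hA : ∃ a ∈ A, G.Reachable w a)
    (hB : ∃ b ∈ B, G.Reachable w b)
    (hsep : ∀ x ≠ w, ∃ z ∈ A ∪ B, ∃ q : G.Walk w z, x ∉ q.support) :
    ∃ a ∈ A, ∃ b ∈ B, ∃ p : G.Walk a b, p.IsPath ∧ w ∈ p.support := by
  classical
  -- Among all paths from `A` to `B`, one that comes closest to `w` must contain `w`.
  let close : ℕ → Prop := fun r => ∃ a ∈ A, ∃ b ∈ B, ∃ P : G.Walk a b, P.IsPath ∧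
    ∃ v ∈ P.support, ∃ q : G.Walk v w, q.length = r
  have hex : ∃ r, close r := by
    obtain ⟨a, ha, ⟨qa⟩⟩ := hA
    obtain ⟨b, hb, ⟨qb⟩⟩ := hB
    exact ⟨_, a, ha, b, hb, (qa.reverse.append qb).bypass, SimpleGraph.Walk.bypass_isPath _, a,
      SimpleGraph.Walk.start_mem_support _, qa.reverse, rfl⟩
  have hmin : ∀ r < Nat.find hex, ¬ close r := fun r hr => Nat.find_min hex hr
  obtain ⟨a, ha, b, hb, P, hP, v, hv, q, hq⟩ := Nat.find_spec hex
  cases q with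
  | nil => exact ⟨a, ha, b, hb, P, hP, hv⟩
  | @cons _ y _ h q' =>
    exfalso
    rw [SimpleGraph.Walk.length_cons] at hq
    have hclose : ∀ a ∈ A, ∀ b ∈ B, ∀ P : G.Walk a b, P.IsPath → y ∉ P.support :=
      fun a ha b hb P hP hy => hmin q'.length (by omega) ⟨a, ha, b, hb, P, hP, y, hy, q', rfl⟩
    have hvq : v ∉ q'.support := fun hvq =>
      hmin (q'.dropUntil v hvq).length
        (by have := q'.length_dropUntil_le_length hvq; omega) ⟨a, ha, b, hb, P, hP, v, hv, _, rfl⟩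
    have hvw : v ≠ w := fun e => hvq (e ▸ q'.end_mem_support)
    obtain ⟨z₀, hz₀, q₀, hq₀⟩ := hsep v hvw
    obtain ⟨z, hz, R, hR, hRq, hRZ⟩ := exists_isPath_first_mem (A ∪ B ∪ {x | x ∈ P.support})
      (q'.append q₀) (Or.inl hz₀)
    have hvR : v ∉ R.support := fun hvR => by
      have := hRq v hvR
      rw [SimpleGraph.Walk.mem_support_append_iff] at this
      exact this.elim hvq hq₀
    have hd : ∀ x ∈ R.support, x ∈ P.support → x = z := fun x hx hxP => hRZ x hx (Or.inr hxP)
    obtain ⟨P₁, P₂, rfl⟩ := SimpleGraph.Walk.mem_support_iff_exists_append.1 hv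
    have hP' : (P₂.reverse.append P₁.reverse).IsPath := by
      rw [← SimpleGraph.Walk.reverse_append]; exact hP.reverse
    by_cases hzP : z ∈ (P₁.append P₂).support
    · rcases (SimpleGraph.Walk.mem_support_append_iff _ _).1 hzP with hz1 | hz2
      · obtain ⟨q, hq, hy⟩ := exists_isPath_reroute hP' h hR (by simpa using hz1) hvR (by
          intro x hx hx'
          apply hd x hx
          rw [SimpleGraph.Walk.mem_support_append_iff] at hx' ⊢
          simpa [or_comm] using hx')
        exact hclose a ha b hb q.reverse hq.reverse (by simpa using hy)
      · obtain ⟨q, hq, hy⟩ := exists_isPath_reroute hP h hR hz2 hvR hd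
        exact hclose a ha b hb q hq hy
    · have hd' : ∀ x ∈ R.support, x ∉ (P₁.append P₂).support := fun x hx hxP =>
        hzP (hd x hx hxP ▸ hxP)
      rcases hz with (hzA | hzB) | hzP'
      · refine hclose z hzA b hb (P₂.reverse.append (.cons h R)).reverse
          (isPath_append_cons hP.of_append_right.reverse hR h ?_).reverse (by simp)
        intro x hx hx'
        exact hd' x hx' (by simp at hx; simp [hx])
      · refine hclose a ha z hzB (P₁.append (.cons h R))
          (isPath_append_cons hP.of_append_left hR h ?_) (by simp)
        intro x hx hx'
        exact hd' x hx' (by simp [hx])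
      · exact hzP hzP'

end Walks

/-! ### Separations, connectivity and identifiability -/

section Connectivity

variable {V : Type*}

theorem vertexConnectivity_le [Fintype V] {G : SimpleGraph V} (K : Finset V)
    (h : ¬ (G.induce ((K : Set V)ᶜ)).Preconnected ∨ ((K : Set V)ᶜ).Subsingleton) :
    vertexConnectivity G ≤ K.card :=
  Nat.sInf_le ⟨K, rfl, h⟩

theorem exists_card_eq_vertexConnectivity [Fintype V] (G : SimpleGraph V) :
    ∃ K : Finset V, K.card = vertexConnectivity G ∧
      (¬ (G.induce ((K : Set V)ᶜ)).Preconnected ∨ ((K : Set V)ᶜ).Subsingleton) :=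
  Nat.sInf_mem (s := {k : ℕ | ∃ K : Finset V, K.card = k ∧
    (¬ (G.induce ((K : Set V)ᶜ)).Preconnected ∨ ((K : Set V)ᶜ).Subsingleton)})
    ⟨_, Finset.univ, rfl, Or.inr (by simp)⟩

/-- Fewer than `κ(G)` vertices do not separate any two of the others. -/
theorem exists_isPath_avoiding [Fintype V] {G : SimpleGraph V} {U : Finset V}
    (hU : U.card < vertexConnectivity G) {a b : V} (ha : a ∉ U) (hb : b ∉ U) :
    ∃ p : G.Walk a b, p.IsPath ∧ ∀ v ∈ p.support, v ∉ U := by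
  classical
  have hc : (G.induce ((U : Set V)ᶜ)).Preconnected := by
    by_contra h
    exact (vertexConnectivity_le U (Or.inl h)).not_gt hU
  obtain ⟨q⟩ := hc ⟨a, by simpa using ha⟩ ⟨b, by simpa using hb⟩
  refine ⟨(q.map (SimpleGraph.Embedding.induce _).toHom).bypass,
    SimpleGraph.Walk.bypass_isPath _, fun v hv => ?_⟩
  have := SimpleGraph.Walk.support_bypass_subset_support _ hv
  obtain ⟨x, -, rfl⟩ := List.mem_map.1 ((SimpleGraph.Walk.support_map _ q) ▸ this)
  exact x.2

/-- `K` splits the rest of the graph into the non-empty parts `C` and `D`, with no edge between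
them. -/
structure IsSeparation (G : SimpleGraph V) (K C D : Finset V) : Prop where
  left_nonempty : C.Nonempty
  right_nonempty : D.Nonempty
  cover : ∀ v, v ∈ C ∨ v ∈ D ∨ v ∈ K
  disjoint : ∀ v ∈ C, v ∉ D
  left_notMem : ∀ v ∈ C, v ∉ K
  right_notMem : ∀ v ∈ D, v ∉ K
  not_adj : ∀ u ∈ C, ∀ v ∈ D, ¬ G.Adj u v

theorem IsSeparation.symm {G : SimpleGraph V} {K C D : Finset V} (h : IsSeparation G K C D) :
    IsSeparation G K D C where
  left_nonempty := h.right_nonempty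
  right_nonempty := h.left_nonempty
  cover v := by have := h.cover v; tauto
  disjoint v hv hv' := h.disjoint v hv' hv
  left_notMem := h.right_notMem
  right_notMem := h.left_notMem
  not_adj u hu v hv e := h.not_adj v hv u hu e.symm

/-- A walk that starts in `C` and avoids `K` cannot leave `C`. -/
theorem IsSeparation.mem_of_walk {G : SimpleGraph V} {K C D : Finset V}
    (h : IsSeparation G K C D) {a b : V} (p : G.Walk a b) (ha : a ∈ C)
    (hp : ∀ v ∈ p.support, v ∉ K) : b ∈ C := by
  induction p with
  | nil => exact ha
  | @cons u v w e p ih =>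
    refine ih ?_ (fun x hx => hp x (by simp [hx]))
    rcases h.cover v with hv | hv | hv
    · exact hv
    · exact absurd e (h.not_adj u ha v hv)
    · exact absurd hv (hp v (by simp))

theorem exists_isSeparation [Fintype V] {G : SimpleGraph V} {K : Finset V}
    (h : ¬ (G.induce ((K : Set V)ᶜ)).Preconnected) : ∃ C D, IsSeparation G K C D := by
  classical
  obtain ⟨a, b, hab⟩ : ∃ a b, ¬ (G.induce ((K : Set V)ᶜ)).Reachable a b := by
    simpa [SimpleGraph.Preconnected] using h
  let C : Finset V := Finset.univ.filter fun v =>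
    ∃ hv : v ∈ ((K : Set V)ᶜ), (G.induce ((K : Set V)ᶜ)).Reachable a ⟨v, hv⟩
  let D : Finset V := Finset.univ.filter fun v => v ∉ K ∧ v ∉ C
  have hCK : ∀ v ∈ C, v ∉ K := fun v hv => by
    obtain ⟨hv, -⟩ := (Finset.mem_filter.1 hv).2
    simpa using hv
  refine ⟨C, D, ⟨a, Finset.mem_filter.2 ⟨Finset.mem_univ _, a.2, .refl a⟩⟩, ⟨b, ?_⟩, ?_, ?_, hCK, ?_, ?_⟩
  · have hb := b.2
    simp only [Set.mem_compl_iff, Finset.mem_coe] at hb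
    simp [D, C, hb, hab]
  · intro v
    by_cases hK : v ∈ K <;> by_cases hC : v ∈ C <;> simp [D, hK, hC]
  · intro v hv hv'
    exact (Finset.mem_filter.1 hv').2.2 hv
  · intro v hv
    exact (Finset.mem_filter.1 hv).2.1
  · intro u hu v hv e
    obtain ⟨hu, hr⟩ := (Finset.mem_filter.1 hu).2
    obtain ⟨hvK, hvC⟩ := (Finset.mem_filter.1 hv).2
    refine hvC (Finset.mem_filter.2 ⟨Finset.mem_univ _, by simpa using hvK, ?_⟩)
    exact hr.trans (SimpleGraph.Adj.reachable (by simpa using e))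

theorem vertexConnectivity_le_card_of_neighbors [Fintype V] {G : SimpleGraph V} (v : V)
    (K : Finset V) (hK : ∀ u, u ∈ K ↔ G.Adj v u) : vertexConnectivity G ≤ K.card := by
  refine vertexConnectivity_le K ?_
  by_contra! h
  obtain ⟨hc, hs⟩ := h
  have hv : v ∈ ((K : Set V)ᶜ) := by simp [hK]
  obtain ⟨u, hu, huv⟩ := hs.exists_ne v
  obtain ⟨q⟩ := hc ⟨v, hv⟩ ⟨u, hu⟩
  cases q with
  | nil => exact huv rfl
  | @cons _ y _ e q =>
    have := y.2
    simp only [Set.mem_compl_iff, Finset.mem_coe, hK] at this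
    exact this (by simpa using e)

end Connectivity

section Identifiability

variable {V : Type*} {G : SimpleGraph V} {S T : Finset V}

theorem mem_usedVertices_iff {v : V} : v ∈ usedVertices G S T ↔
    ∃ s ∈ S, ∃ t ∈ T, ∃ p : G.Walk s t, p.IsPath ∧ v ∈ p.support := by
  constructor
  · rintro ⟨⟨s, t, p⟩, ⟨hs, ht, hp⟩, hv⟩
    exact ⟨s, hs, t, ht, p, hp, hv⟩
  · rintro ⟨s, hs, t, ht, p, hp, hv⟩
    exact ⟨⟨s, t, p⟩, ⟨hs, ht, hp⟩, hv⟩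

theorem separable_comm {U W : Finset V} : Separable G S T U W ↔ Separable G S T W U := by
  rw [Separable, Separable, symmDiff_comm]

theorem separable_of_isPath {U W : Finset V} {s t w : V} (hs : s ∈ S) (ht : t ∈ T)
    (p : G.Walk s t) (hp : p.IsPath) (hw : w ∈ p.support) (hwW : w ∈ W)
    (hU : ∀ v ∈ p.support, v ∉ U) : Separable G S T U W :=
  ⟨⟨s, t, p⟩, Or.inr ⟨⟨⟨hs, ht, hp⟩, w, hwW, hw⟩, fun h => by
    obtain ⟨-, u, hu, hup⟩ := h
    exact hU u hup hu⟩⟩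

theorem le_maxIdentifiability {k : ℕ} (hk : k ≤ (usedVertices G S T).ncard)
    (h : IsIdentifiable G S T (usedVertices G S T) k) : k ≤ maxIdentifiability G S T :=
  le_csSup ⟨_, fun _ hj => hj.1⟩ ⟨hk, h⟩

/-- If the monitoring paths through a used vertex `v` outside `K` all meet `K`, then the used part
of `K` cannot be told apart from itself with `v` added. -/
theorem maxIdentifiability_le_card {K : Finset V} {v : V} (hv : v ∈ usedVertices G S T)
    (hvK : v ∉ K) (h : ∀ s ∈ S, ∀ t ∈ T, ∀ p : G.Walk s t, p.IsPath → v ∈ p.support →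
      ∃ u ∈ K, u ∈ p.support) : maxIdentifiability G S T ≤ K.card := by
  classical
  refine csSup_le' ?_
  rintro k ⟨-, hk⟩
  by_contra! hlt
  let U : Finset V := K.filter (· ∈ usedVertices G S T)
  have hUK : U.card ≤ K.card := Finset.card_filter_le _ _
  have hvU : v ∉ U := fun h => hvK (Finset.mem_filter.1 h).1
  obtain ⟨⟨s, t, p⟩, hsep⟩ := hk U (insert v U) (fun u hu => (Finset.mem_filter.1 hu).2)
    (by
      intro u hu
      rcases Finset.mem_insert.1 hu with rfl | hu
      · exact hv
      · exact (Finset.mem_filter.1 hu).2)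
    (fun e => hvU (e ▸ Finset.mem_insert_self v U)) (by omega)
    ((Finset.card_insert_le _ _).trans (by omega))
  rcases hsep with ⟨⟨hm, u, hu, hup⟩, hn⟩ | ⟨⟨⟨hs, ht, hp⟩, u, hu, hup⟩, hn⟩
  · exact hn ⟨hm, u, Finset.mem_insert_of_mem hu, hup⟩
  · refine hn ⟨⟨hs, ht, hp⟩, ?_⟩
    rcases Finset.mem_insert.1 hu with rfl | hu
    · obtain ⟨x, hx, hxp⟩ := h s hs t ht p hp hup
      exact ⟨x, Finset.mem_filter.2 ⟨hx, mem_usedVertices_iff.2 ⟨s, hs, t, ht, p, hp, hxp⟩⟩, hxp⟩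
    · exact ⟨u, hu, hup⟩

/-- A path with two different end-points enters or leaves each of its vertices. -/
theorem exists_adj_mem_support {s t v : V} (hst : s ≠ t) (p : G.Walk s t) (hv : v ∈ p.support) :
    ∃ u ∈ p.support, G.Adj v u := by
  classical
  have key : ∀ {x : V} (q : G.Walk v x), v ≠ x → ∃ u ∈ q.support, G.Adj v u := by
    intro x q hx
    cases q with
    | nil => exact absurd rfl hx
    | cons e q => exact ⟨_, by simp, e⟩
  by_cases hvt : v = t
  · obtain ⟨u, hu, e⟩ := key (p.takeUntil v hv).reverse (fun h => hst (h.symm.trans hvt))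
    exact ⟨u, p.support_takeUntil_subset_support hv (by simpa using hu), e⟩
  · obtain ⟨u, hu, e⟩ := key (p.dropUntil v hv) hvt
    exact ⟨u, p.support_dropUntil_subset_support hv hu, e⟩

/-- Up to `κ(G) - 1` failed vertices never cut off a monitor from the monitors of the other
kind. -/
theorem separable_of_mem_left [Fintype V] {U W : Finset V} (hU : U.card < vertexConnectivity G)
    {w t : V} (hw : w ∈ W) (hwU : w ∉ U) (hwS : w ∈ S) (ht : t ∈ T) (htU : t ∉ U) :
    Separable G S T U W := by
  obtain ⟨p, hp, hpU⟩ := exists_isPath_avoiding hU hwU htU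
  exact separable_of_isPath hwS ht p hp p.start_mem_support hw hpU

theorem separable_of_mem_right [Fintype V] {U W : Finset V} (hU : U.card < vertexConnectivity G)
    {w s : V} (hw : w ∈ W) (hwU : w ∉ U) (hwT : w ∈ T) (hs : s ∈ S) (hsU : s ∉ U) :
    Separable G S T U W := by
  obtain ⟨p, hp, hpU⟩ := exists_isPath_avoiding hU hsU hwU
  exact separable_of_isPath hs hwT p hp p.end_mem_support hw hpU

theorem mem_usedVertices_of_mem [Fintype V] (hκ : 0 < vertexConnectivity G) (hS : S.Nonempty)
    (hT : T.Nonempty) {v : V} (hv : v ∈ S ∨ v ∈ T) : v ∈ usedVertices G S T := by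
  obtain ⟨s, hs⟩ := hS
  obtain ⟨t, ht⟩ := hT
  rcases hv with hv | hv
  · obtain ⟨p, hp, -⟩ := exists_isPath_avoiding (G := G) (U := ∅) hκ (a := v) (b := t) (by simp)
      (by simp)
    exact mem_usedVertices_iff.2 ⟨v, hv, t, ht, p, hp, p.start_mem_support⟩
  · obtain ⟨p, hp, -⟩ := exists_isPath_avoiding (G := G) (U := ∅) hκ (a := s) (b := v) (by simp)
      (by simp)
    exact mem_usedVertices_iff.2 ⟨s, hs, v, hv, p, hp, p.end_mem_support⟩

theorem le_ncard_usedVertices [Fintype V] (hκ : 0 < vertexConnectivity G) (hS : S.Nonempty)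
    (hT : T.Nonempty) : S.card ≤ (usedVertices G S T).ncard := by
  rw [← Set.ncard_coe_finset]
  exact Set.ncard_le_ncard
    (fun v hv => mem_usedVertices_of_mem hκ hS hT (Or.inl (by simpa using hv))) (Set.toFinite _)

/-- If every vertex is a monitor, then identifiability can only fail by exhausting the monitors of
one kind. -/
theorem vertexConnectivity_le_maxIdentifiability_add_one [Fintype V]
    (hcover : ∀ v, v ∈ S ∨ v ∈ T) (hS : S.Nonempty) (hT : T.Nonempty)
    (hSκ : vertexConnectivity G ≤ S.card) (hTκ : vertexConnectivity G ≤ T.card + 1) :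
    vertexConnectivity G ≤ maxIdentifiability G S T + 1 := by
  rcases Nat.eq_zero_or_pos (vertexConnectivity G) with h0 | hκ
  · omega
  suffices h : vertexConnectivity G - 1 ≤ maxIdentifiability G S T by omega
  refine le_maxIdentifiability
    ((Nat.sub_le _ _).trans (hSκ.trans (le_ncard_usedVertices hκ hS hT))) ?_
  have hSU : ∀ {U : Finset V}, U.card < vertexConnectivity G → ∃ s ∈ S, s ∉ U := fun hU => by
    by_contra! h
    exact absurd (Finset.card_le_card h) (by omega)
  have key : ∀ U W : Finset V, U.card ≤ vertexConnectivity G - 1 →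
      W.card ≤ vertexConnectivity G - 1 → ∀ w ∈ W, w ∉ U → Separable G S T U W := by
    intro U W hU hW w hwW hwU
    rcases hcover w with hw | hw
    · by_cases hTU : ∃ t ∈ T, t ∉ U
      · obtain ⟨t, ht, htU⟩ := hTU
        exact separable_of_mem_left (by omega) hwW hwU hw ht htU
      · -- Then `U = T`, and `W` misses a vertex of `T`, which can be separated from `W` instead.
        push Not at hTU
        have hUT : T = U := Finset.eq_of_subset_of_card_le hTU (by omega)
        obtain ⟨u, hu, huW⟩ : ∃ u ∈ T, u ∉ W := by
          by_contra! h
          have hTW : T = W := Finset.eq_of_subset_of_card_le h (by omega)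
          exact hwU (hUT ▸ hTW ▸ hwW)
        obtain ⟨s, hs, hsW⟩ := hSU (U := W) (by omega)
        exact separable_comm.1 (separable_of_mem_right (by omega) (hUT ▸ hu) huW hu hs hsW)
    · obtain ⟨s, hs, hsU⟩ := hSU (U := U) (by omega)
      exact separable_of_mem_right (by omega) hwW hwU hw hs hsU
  intro U W _ _ hne hU hW
  by_cases h : W ⊆ U
  · obtain ⟨u, hu, huW⟩ := Finset.not_subset.1 fun h' => hne (h'.antisymm h)
    exact separable_comm.1 (key W U hW hU u hu huW)
  · obtain ⟨w, hw, hwU⟩ := Finset.not_subset.1 h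
    exact key U W hU hW w hw hwU

/-- For the placement, take a minimum separator `K` with sides `C` and `D`, where `C` is not larger
than `D`, and let `S = D` and `T = C ∪ K`. -/
theorem exists_placement_of_three_mul_le [Fintype V] (G : SimpleGraph V)
    (hV : 2 ≤ Fintype.card V) (h3 : 3 * vertexConnectivity G ≤ Fintype.card V) :
    ∃ S T : Finset V, IsMonitorPlacement S T ∧
      vertexConnectivity G ≤ maxIdentifiability G S T + 1 ∧
      maxIdentifiability G S T ≤ vertexConnectivity G := by
  classical
  obtain ⟨K, hK, h⟩ := exists_card_eq_vertexConnectivity G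
  have hsep : ∃ C D, IsSeparation G K C D := by
    rcases h with h | h
    · exact exists_isSeparation h
    · exfalso
      have h1 : (Kᶜ).card ≤ 1 := Finset.card_le_one.2 fun a ha b hb =>
        h (by simpa using ha) (by simpa using hb)
      have := Finset.card_add_card_compl K
      omega
  obtain ⟨C, D, hCD, hle⟩ : ∃ C D, IsSeparation G K C D ∧ C.card ≤ D.card := by
    obtain ⟨C, D, h⟩ := hsep
    rcases le_total C.card D.card with hc | hc
    exacts [⟨C, D, h, hc⟩, ⟨D, C, h.symm, hc⟩]
  have hcard : Fintype.card V ≤ C.card + (D.card + K.card) := by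
    rw [← Finset.card_univ]
    refine (Finset.card_le_card (t := C ∪ (D ∪ K)) fun v _ => ?_).trans
      ((Finset.card_union_le _ _).trans (Nat.add_le_add_left (Finset.card_union_le _ _) _))
    simpa using hCD.cover v
  have hTc : (C ∪ K).card = C.card + K.card :=
    Finset.card_union_of_disjoint (Finset.disjoint_left.2 hCD.left_notMem)
  have hdisj : Disjoint D (C ∪ K) := Finset.disjoint_left.2 fun v hv hv' =>
    (Finset.mem_union.1 hv').elim (fun h => hCD.disjoint v h hv) (hCD.right_notMem v hv)
  have hT : (C ∪ K).Nonempty := hCD.left_nonempty.mono Finset.subset_union_left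
  refine ⟨D, C ∪ K, ⟨hCD.right_nonempty, hT, hdisj⟩, ?_, ?_⟩
  · refine vertexConnectivity_le_maxIdentifiability_add_one (fun v => ?_)
      hCD.right_nonempty hT (by omega) (by omega)
    have := hCD.cover v
    simp only [Finset.mem_union]
    tauto
  · have hmeet : ∀ v ∈ C, ∀ s ∈ D, ∀ t ∈ C ∪ K, ∀ p : G.Walk s t, p.IsPath → v ∈ p.support →
        ∃ u ∈ K, u ∈ p.support := by
      intro v hv s hs t ht p hp hvp
      by_contra! hn
      exact hCD.disjoint v hv (hCD.symm.mem_of_walk (p.takeUntil v hvp) hs fun x hx hxK =>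
        hn x hxK (p.support_takeUntil_subset_support hvp hx))
    obtain ⟨v, hv⟩ := hCD.left_nonempty
    by_cases hvN : v ∈ usedVertices G D (C ∪ K)
    · exact hK ▸ maxIdentifiability_le_card hvN (hCD.left_notMem v hv) (hmeet v hv)
    · -- The only way for `v` to be unused is that no monitoring path exists, with `κ(G) = 0`.
      have h0 : vertexConnectivity G = 0 := by
        by_contra h0
        exact hvN (mem_usedVertices_of_mem (Nat.pos_of_ne_zero h0) hCD.right_nonempty hT
          (Or.inr (Finset.mem_union_left _ hv)))
      have hK0 : K = ∅ := Finset.card_eq_zero.1 (hK.trans h0)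
      have hN : usedVertices G D (C ∪ K) = ∅ := by
        rw [Set.eq_empty_iff_forall_notMem]
        intro x hx
        obtain ⟨s, hs, t, ht, p, hp, -⟩ := mem_usedVertices_iff.1 hx
        obtain ⟨u, hu, -⟩ := hmeet t (by simpa [hK0] using ht) s hs t ht p hp p.end_mem_support
        simp [hK0] at hu
      refine csSup_le' ?_
      rintro k ⟨hk, -⟩
      rw [hN, Set.ncard_empty] at hk
      exact hk.trans (Nat.zero_le _)

end Identifiability

/-! ### Separations of layered products -/

section Layers

theorem sum_card_layer_le {X : Type*} {n : ℕ} {K : Finset (X × Fin n)} (s : Finset (Fin n)) :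
    ∑ i ∈ s, (K.filter (·.2 = i)).card ≤ K.card := by
  rw [Finset.card_eq_sum_card_fiberwise (s := K) (f := Prod.snd) (t := Finset.univ)
    (fun _ _ => Finset.mem_coe.2 (Finset.mem_univ _))]
  exact Finset.sum_le_sum_of_subset (Finset.subset_univ s)

variable {X : Type*} [Fintype X] [DecidableEq X] {n : ℕ}

/-- A set `K` that splits the rest of a product `X × Fin n` into `C` and `D`. Only the columns
`{x} × Fin n` carry a relation `near` that must not link `C` to `D`; about the layers `X × {i}` it is
only assumed that a layer meeting both `C` and `D` contains at least `e * m` elements of `K`. Here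
`m` is a lower bound for the connectivity of the columns and `e * m` for that of the layers, as in
the case that `X` is a product of `e` copies of `Fin n`. -/
structure IsLayeredSeparation (m e : ℕ) (near : Fin n → Fin n → Prop)
    (K C D : Finset (X × Fin n)) : Prop where
  left_nonempty : C.Nonempty
  right_nonempty : D.Nonempty
  cover : ∀ p, p ∈ C ∨ p ∈ D ∨ p ∈ K
  disjoint : ∀ p ∈ C, p ∉ D
  near_symm : ∀ i j, near i j → near j i
  not_near : ∀ x i j, near i j → (x, i) ∈ C → (x, j) ∉ D
  window : ∀ i, ∃ w : Finset (Fin n), i ∉ w ∧ m ≤ w.card ∧ ∀ j ∈ w, near i j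
  column : ∀ x i j, (x, i) ∈ C → (x, j) ∈ D →
    2 ≤ m ∧ m + 2 ≤ n ∧ m ≤ (K.filter (·.1 = x)).card
  layer : ∀ i x y, (x, i) ∈ C → (y, i) ∈ D →
    1 ≤ e ∧ (e = 1 → 2 ≤ m ∧ m + 2 ≤ n) ∧ e * m ≤ (K.filter (·.2 = i)).card
  one_le : 1 ≤ m
  lt : m + 1 ≤ n
  le_card : 1 + e * (n - 1) ≤ Fintype.card X
  lt_card : 2 ≤ e → 2 + e * (n - 1) ≤ Fintype.card X
  card_eq : e = 1 → Fintype.card X = n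

namespace IsLayeredSeparation

variable {m e : ℕ} {near : Fin n → Fin n → Prop} {K C D : Finset (X × Fin n)}

theorem symm (h : IsLayeredSeparation m e near K C D) : IsLayeredSeparation m e near K D C where
  left_nonempty := h.right_nonempty
  right_nonempty := h.left_nonempty
  cover p := by have := h.cover p; tauto
  disjoint p hp hp' := h.disjoint p hp' hp
  near_symm := h.near_symm
  not_near x i j hij hi hj := h.not_near x j i (h.near_symm i j hij) hj hi
  window := h.window
  column x i j hi hj := h.column x j i hj hi
  layer i x y hx hy := h.layer i y x hy hx
  one_le := h.one_le
  lt := h.lt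
  le_card := h.le_card
  lt_card := h.lt_card
  card_eq := h.card_eq

theorem mem_separator (h : IsLayeredSeparation m e near K C D) {p : X × Fin n} (hC : p ∉ C)
    (hD : p ∉ D) : p ∈ K := by
  have := h.cover p
  tauto

theorem le_card_fst (h : IsLayeredSeparation m e near K C D) (he : 1 ≤ e) :
    n ≤ Fintype.card X := by
  have h1 := h.le_card
  have h2 := h.lt
  have : 1 * (n - 1) ≤ e * (n - 1) := Nat.mul_le_mul_right _ he
  omega

/-- No layer and no column meets both parts: the parts lie in two boxes with disjoint sides. -/
theorem le_card_of_unmixed (h : IsLayeredSeparation m e near K C D)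
    (hl : ∀ i x y, (x, i) ∈ C → (y, i) ∉ D) (hc : ∀ x i j, (x, i) ∈ C → (x, j) ∉ D) :
    (e + 1) * m ≤ K.card ∧ (1 ≤ e → 2 ≤ C.card → 2 ≤ D.card → (e + 1) * m + 1 ≤ K.card) := by
  have hbox : ∀ E : Finset (X × Fin n), E ⊆ (E.image Prod.fst) ×ˢ (E.image Prod.snd) := fun E p hp =>
    Finset.mem_product.2 ⟨Finset.mem_image_of_mem _ hp, Finset.mem_image_of_mem _ hp⟩
  have hpos : ∀ E : Finset (X × Fin n), E.Nonempty →
      1 ≤ (E.image Prod.fst).card ∧ 1 ≤ (E.image Prod.snd).card := fun E hE =>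
    ⟨Finset.card_pos.2 (hE.image _), Finset.card_pos.2 (hE.image _)⟩
  have hCb := Finset.card_le_card (hbox C)
  have hDb := Finset.card_le_card (hbox D)
  rw [Finset.card_product] at hCb hDb
  obtain ⟨ha, hi⟩ := hpos C h.left_nonempty
  obtain ⟨hb, hj⟩ := hpos D h.right_nonempty
  have hab : (C.image Prod.fst).card + (D.image Prod.fst).card ≤ Fintype.card X := by
    rw [← Finset.card_union_of_disjoint]
    · exact Finset.card_le_univ _
    · rw [Finset.disjoint_left]
      intro x hx hx'
      obtain ⟨⟨x, i⟩, hp, rfl⟩ := Finset.mem_image.1 hx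
      obtain ⟨⟨y, j⟩, hq, hxy⟩ := Finset.mem_image.1 hx'
      obtain rfl : y = x := hxy
      exact hc _ i j hp hq
  have hij : (C.image Prod.snd).card + (D.image Prod.snd).card ≤ n := by
    rw [← Finset.card_union_of_disjoint]
    · exact (Finset.card_le_univ _).trans_eq (Fintype.card_fin n)
    · rw [Finset.disjoint_left]
      intro x hx hx'
      obtain ⟨⟨x, i⟩, hp, rfl⟩ := Finset.mem_image.1 hx
      obtain ⟨⟨y, j⟩, hq, hxy⟩ := Finset.mem_image.1 hx'
      obtain rfl : j = i := hxy
      exact hl _ x y hp hq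
  have hcov : Fintype.card X * n ≤ C.card + (D.card + K.card) := by
    have : Fintype.card X * n = (Finset.univ : Finset (X × Fin n)).card := by simp
    rw [this]
    refine (Finset.card_le_card (t := C ∪ (D ∪ K)) fun p _ => ?_).trans
      ((Finset.card_union_le _ _).trans (Nat.add_le_add_left (Finset.card_union_le _ _) _))
    simpa using h.cover p
  have h1 := h.le_card
  have h2 := h.lt
  have h3 := h.lt_card
  have h4 := h.card_eq
  have hm : (e + 1) * m ≤ (e + 1) * (n - 1) := Nat.mul_le_mul_left _ (by omega)
  rw [Nat.add_mul, Nat.one_mul, Nat.add_mul, Nat.one_mul] at hm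
  rw [Nat.add_mul, Nat.one_mul]
  generalize (C.image Prod.fst).card = a at *
  generalize (D.image Prod.fst).card = b at *
  generalize (C.image Prod.snd).card = i at *
  generalize (D.image Prod.snd).card = j at *
  generalize Fintype.card X = N at *
  have hlow : N + n ≤ K.card + 2 := by
    obtain ⟨s, rfl⟩ := Nat.exists_eq_add_of_le hab
    obtain ⟨t, rfl⟩ := Nat.exists_eq_add_of_le hij
    obtain ⟨a, rfl⟩ := Nat.exists_eq_add_of_le ha
    obtain ⟨b, rfl⟩ := Nat.exists_eq_add_of_le hb
    obtain ⟨i, rfl⟩ := Nat.exists_eq_add_of_le hi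
    obtain ⟨j, rfl⟩ := Nat.exists_eq_add_of_le hj
    nlinarith [Nat.zero_le (a * j), Nat.zero_le (b * i), Nat.zero_le (a * t), Nat.zero_le (b * t),
      Nat.zero_le (s * i), Nat.zero_le (s * j), Nat.zero_le (s * t)]
  refine ⟨by omega, fun he hC2 hD2 => ?_⟩
  rcases he.eq_or_lt with rfl | he
  · have hN := h4 rfl
    subst hN
    have hstrict : N + N ≤ K.card + 1 := by
      obtain ⟨s, hs⟩ := Nat.exists_eq_add_of_le hab
      obtain ⟨t, ht⟩ := Nat.exists_eq_add_of_le hij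
      obtain ⟨a, rfl⟩ := Nat.exists_eq_add_of_le ha
      obtain ⟨b, rfl⟩ := Nat.exists_eq_add_of_le hb
      obtain ⟨i, rfl⟩ := Nat.exists_eq_add_of_le hi
      obtain ⟨j, rfl⟩ := Nat.exists_eq_add_of_le hj
      have e1 : N * N = (1 + a + (1 + b) + s) * (1 + i + (1 + j) + t) := by rw [← hs, ← ht]
      have hai : 1 ≤ a + i := by
        by_contra! h0
        obtain ⟨rfl, rfl⟩ : a = 0 ∧ i = 0 := by omega
        omega
      have hbj : 1 ≤ b + j := by
        by_contra! h0
        obtain ⟨rfl, rfl⟩ : b = 0 ∧ j = 0 := by omega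
        omega
      -- With the sides of the boxes shifted by one, the left-hand side below exceeds `N + N` by
      -- quantities of which one is positive unless a box is a single point.
      have hk : a * j + b * i + s + t + N + N ≤ K.card + 2 := by
        nlinarith [Nat.zero_le (a * t), Nat.zero_le (b * t),
          Nat.zero_le (s * i), Nat.zero_le (s * j), Nat.zero_le (s * t)]
      have hpos : 1 ≤ a * j + b * i + s + t := by
        by_contra! h0
        have haj : a * j = 0 := by omega
        have hbi : b * i = 0 := by omega
        rcases Nat.mul_eq_zero.1 haj with h | h <;> rcases Nat.mul_eq_zero.1 hbi with h' | h' <;>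
          omega
      omega
    omega
  · have := h3 he
    omega

/-- A column cannot avoid `K` altogether as soon as it crosses a layer without `D` and a layer
without `C`. -/
theorem exists_mem_separator (h : IsLayeredSeparation m e near K C D) {i j : Fin n}
    (hi : ∀ y, (y, i) ∉ D) (hj : ∀ y, (y, j) ∉ C) (x : X) :
    (x, i) ∈ K ∨ (x, j) ∈ K ∨ 2 ≤ m ∧ m ≤ (K.filter (·.1 = x)).card := by
  rcases h.cover (x, i) with h1 | h1 | h1
  · rcases h.cover (x, j) with h2 | h2 | h2
    · exact absurd h2 (hj x)
    · have := h.column x i j h1 h2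
      exact Or.inr (Or.inr ⟨this.1, this.2.2⟩)
    · exact Or.inr (Or.inl h2)
  · exact absurd h1 (hi x)
  · exact Or.inl h1

theorem le_card_of_mixed_column (h : IsLayeredSeparation m e near K C D)
    (hl : ∀ i x y, (x, i) ∈ C → (y, i) ∉ D) {x₀ : X} {i₀ j₀ : Fin n} (h₀ : (x₀, i₀) ∈ C)
    (h₁ : (x₀, j₀) ∈ D) :
    (e + 1) * m ≤ K.card ∧ (1 ≤ e → (e + 1) * m + 1 ≤ K.card) := by
  obtain ⟨hm2, hmn, hcol⟩ := h.column _ _ _ h₀ h₁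
  have hone : ∀ x, 1 ≤ (K.filter (·.1 = x)).card := by
    intro x
    rcases h.exists_mem_separator (i := i₀) (j := j₀) (fun y hy => hl _ _ _ h₀ hy)
      (fun y hy => hl _ _ _ hy h₁) x with h2 | h2 | h2
    · exact Finset.card_pos.2 ⟨_, Finset.mem_filter.2 ⟨h2, rfl⟩⟩
    · exact Finset.card_pos.2 ⟨_, Finset.mem_filter.2 ⟨h2, rfl⟩⟩
    · omega
  have hsum : K.card = ∑ x, (K.filter (·.1 = x)).card :=
    Finset.card_eq_sum_card_fiberwise fun _ _ => Finset.mem_coe.2 (Finset.mem_univ _)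
  rw [← Finset.add_sum_erase _ _ (Finset.mem_univ x₀)] at hsum
  have hrest : ((Finset.univ : Finset X).erase x₀).card ≤
      ∑ x ∈ Finset.univ.erase x₀, (K.filter (·.1 = x)).card := by
    rw [Finset.card_eq_sum_ones]
    exact Finset.sum_le_sum fun x _ => hone x
  rw [Finset.card_erase_of_mem (Finset.mem_univ _), Finset.card_univ] at hrest
  have h1 := h.le_card
  have h2 : e * (m + 1) ≤ e * (n - 1) := Nat.mul_le_mul_left _ (by omega)
  rw [Nat.mul_add] at h2
  rw [Nat.add_mul]
  omega

/-- Exactly one layer meets both parts: the other layers contain at least `m` further elements of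
`K`, and `m + 1` unless one part is a single point. -/
theorem le_card_of_one_mixed_layer (h : IsLayeredSeparation m e near K C D) {i₀ : Fin n} {x₀ y₀ : X}
    (h₀ : (x₀, i₀) ∈ C) (h₁ : (y₀, i₀) ∈ D)
    (hl : ∀ i ≠ i₀, ∀ x y, (x, i) ∈ C → (y, i) ∉ D) :
    (e + 1) * m ≤ K.card ∧ (2 ≤ C.card → 2 ≤ D.card → (e + 1) * m + 1 ≤ K.card) := by
  obtain ⟨he, -, hq⟩ := h.layer _ _ _ h₀ h₁
  have hn := h.le_card_fst he
  have hmn := h.lt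
  have hm1 := h.one_le
  have hsplit : (K.filter (·.2 = i₀)).card + (K.filter (¬ ·.2 = i₀)).card = K.card :=
    Finset.card_filter_add_card_filter_not _
  suffices hmain : m ≤ (K.filter (¬ ·.2 = i₀)).card ∧
      (2 ≤ C.card → 2 ≤ D.card → m + 1 ≤ (K.filter (¬ ·.2 = i₀)).card) by
    rw [Nat.add_mul, Nat.one_mul]
    refine ⟨by omega, fun hC hD => ?_⟩
    have := hmain.2 hC hD
    omega
  -- If one part lives in layer `i₀` only, each of its points has `m` near elements of `K`.
  have hconf : ∀ {C D : Finset (X × Fin n)}, IsLayeredSeparation m e near K C D → D.Nonempty →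
      (∀ p ∈ D, p.2 = i₀) → m ≤ (K.filter (¬ ·.2 = i₀)).card ∧
      (2 ≤ C.card → 2 ≤ D.card → m + 1 ≤ (K.filter (¬ ·.2 = i₀)).card) := by
    intro C D h hDne hD
    obtain ⟨w, hw, hmw, hnear⟩ := h.window i₀
    have hcard : D.card * m ≤ (K.filter (¬ ·.2 = i₀)).card := by
      refine (Nat.mul_le_mul_left _ hmw).trans ?_
      rw [← Finset.card_product]
      refine Finset.card_le_card_of_injOn (fun r => (r.1.1, r.2)) ?_ ?_
      · rintro ⟨⟨y, i⟩, j⟩ hr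
        obtain ⟨hy, hj⟩ := Finset.mem_product.1 hr
        obtain rfl : i = i₀ := hD _ hy
        have hji : j ≠ i := fun e => hw (e ▸ hj)
        refine Finset.mem_filter.2 ⟨h.mem_separator ?_ fun hy' => hji (hD _ hy'), hji⟩
        exact fun hy' => h.not_near _ _ _ (h.near_symm _ _ (hnear j hj)) hy' hy
      · rintro ⟨⟨y, i⟩, j⟩ hr ⟨⟨y', i'⟩, j'⟩ hr' heq
        have h1 : i = i₀ := hD _ (Finset.mem_product.1 hr).1
        have h2 : i' = i₀ := hD _ (Finset.mem_product.1 hr').1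
        simp only [Prod.mk.injEq] at heq ⊢
        exact ⟨⟨heq.1, h1.trans h2.symm⟩, heq.2⟩
    have h1 : 1 * m ≤ D.card * m := Nat.mul_le_mul_right _ (Finset.card_pos.2 hDne)
    refine ⟨by omega, fun _ hD2 => ?_⟩
    have h2 : 2 * m ≤ D.card * m := Nat.mul_le_mul_right _ hD2
    omega
  by_cases hD : ∀ p ∈ D, p.2 = i₀
  · exact hconf h h.right_nonempty hD
  by_cases hC : ∀ p ∈ C, p.2 = i₀
  · have := hconf h.symm h.left_nonempty hC
    tauto
  -- Otherwise every column has an element of `K` outside layer `i₀`.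
  push Not at hC hD
  obtain ⟨⟨x, i⟩, hxC, hi⟩ := hC
  obtain ⟨⟨y, j⟩, hyD, hj⟩ := hD
  suffices hX : Fintype.card X ≤ (K.filter (¬ ·.2 = i₀)).card from
    ⟨by omega, fun _ _ => by omega⟩
  have himg : (Finset.univ : Finset X) ⊆ (K.filter (¬ ·.2 = i₀)).image Prod.fst := by
    intro z _
    rw [Finset.mem_image]
    rcases h.exists_mem_separator (i := i) (j := j) (fun z hz => hl i hi _ _ hxC hz)
      (fun z hz => hl j hj _ _ hz hyD) z with h2 | h2 | ⟨h2, h3⟩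
    · exact ⟨_, Finset.mem_filter.2 ⟨h2, hi⟩, rfl⟩
    · exact ⟨_, Finset.mem_filter.2 ⟨h2, hj⟩, rfl⟩
    · obtain ⟨p, hp, hne⟩ := Finset.exists_mem_ne (by omega : 1 < (K.filter (·.1 = z)).card) (z, i₀)
      obtain ⟨hpK, rfl⟩ := Finset.mem_filter.1 hp
      exact ⟨p, Finset.mem_filter.2 ⟨hpK, fun e => hne (Prod.ext rfl e)⟩, rfl⟩
  exact (Finset.card_le_card himg).trans Finset.card_image_le

theorem le_card_of_two_mixed_layers (h : IsLayeredSeparation m e near K C D) {i₀ i₁ : Fin n}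
    (hne : i₀ ≠ i₁) {x₀ y₀ x₁ y₁ : X} (hx₀ : (x₀, i₀) ∈ C) (hy₀ : (y₀, i₀) ∈ D)
    (hx₁ : (x₁, i₁) ∈ C) (hy₁ : (y₁, i₁) ∈ D) : (e + 1) * m + 1 ≤ K.card := by
  obtain ⟨he, he1, hq₀⟩ := h.layer _ _ _ hx₀ hy₀
  obtain ⟨-, -, hq₁⟩ := h.layer _ _ _ hx₁ hy₁
  have hm := h.one_le
  have h2 := sum_card_layer_le (K := K) {i₀, i₁}
  rw [Finset.sum_pair hne] at h2
  rw [Nat.add_mul, Nat.one_mul]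
  rcases he.eq_or_lt with rfl | he
  · obtain ⟨hm2, hmn⟩ := he1 rfl
    have hN := h.card_eq rfl
    by_contra! hlt
    -- Now `K` lies in the layers `i₀` and `i₁`, hence all others lie in `C`, or all in `D`.
    have hK : ∀ i, i ≠ i₀ → i ≠ i₁ → (K.filter (·.2 = i)).card = 0 := by
      intro i h0 h1
      have h3 := sum_card_layer_le (K := K) {i₀, i₁, i}
      rw [Finset.sum_insert (by simp [hne, h0.symm]), Finset.sum_pair h1.symm] at h3
      omega
    have hKn : ∀ i x, i ≠ i₀ → i ≠ i₁ → (x, i) ∉ K := by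
      intro i x h0 h1 hx
      have : (x, i) ∈ K.filter (·.2 = i) := Finset.mem_filter.2 ⟨hx, rfl⟩
      rw [Finset.card_eq_zero.1 (hK i h0 h1)] at this
      exact Finset.notMem_empty _ this
    have hpure : ∀ {C D : Finset (X × Fin n)}, IsLayeredSeparation m 1 near K C D →
        ∀ i x, i ≠ i₀ → i ≠ i₁ → (x, i) ∈ C → ∀ y, (y, i) ∈ C := by
      intro C D h i x h0 h1 hx y
      rcases h.cover (y, i) with h3 | h3 | h3
      · exact h3
      · have := (h.layer _ _ _ hx h3).2.2
        have := hK i h0 h1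
        omega
      · exact absurd h3 (hKn i y h0 h1)
    obtain ⟨i₂, hi₂⟩ : ∃ i, i ∉ ({i₀, i₁} : Finset (Fin n)) := by
      by_contra! hall
      have := Finset.card_le_card (fun i _ => hall i : Finset.univ ⊆ ({i₀, i₁} : Finset (Fin n)))
      rw [Finset.card_pair hne, Finset.card_univ, Fintype.card_fin] at this
      omega
    simp only [Finset.mem_insert, Finset.mem_singleton, not_or] at hi₂
    have key : ∀ {C D : Finset (X × Fin n)}, IsLayeredSeparation m 1 near K C D →
        ∀ y, (y, i₀) ∈ D → (y, i₂) ∉ C := by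
      intro C D h y hD hC
      have hlay := hpure h i₂ y hi₂.1 hi₂.2 hC
      obtain ⟨w, hw, hmw, hnear⟩ := h.window i₀
      obtain ⟨j, hj, hj1⟩ := Finset.exists_mem_ne (by omega : 1 < w.card) i₁
      have hj0 : j ≠ i₀ := fun e => hw (e ▸ hj)
      have hjD : (y, j) ∈ D := by
        rcases h.cover (y, j) with h3 | h3 | h3
        · exact absurd hD (h.not_near _ _ _ (h.near_symm _ _ (hnear j hj)) h3)
        · exact h3
        · exact absurd h3 (hKn j y hj0 hj1)
      have hlayj := hpure h.symm j y hj0 hj1 hjD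
      have hsum : K.card = ∑ x : X, (K.filter (·.1 = x)).card :=
        Finset.card_eq_sum_card_fiberwise fun _ _ => Finset.mem_coe.2 (Finset.mem_univ _)
      have : Fintype.card X * m ≤ K.card := by
        rw [hsum, ← Finset.card_univ, ← smul_eq_mul]
        exact Finset.card_nsmul_le_sum _ _ _ fun x _ => (h.column x i₂ j (hlay x) (hlayj x)).2.2
      rw [hN] at this
      have h5 : (m + 2) * m ≤ n * m := Nat.mul_le_mul_right _ hmn
      nlinarith
    rcases h.cover (y₀, i₂) with h3 | h3 | h3
    · exact key h y₀ hy₀ h3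
    · exact key h.symm x₀ hx₀ (hpure h.symm i₂ y₀ hi₂.1 hi₂.2 h3 x₀)
    · exact absurd h3 (hKn i₂ y₀ hi₂.1 hi₂.2)
  · have h3 : 2 * m ≤ e * m := Nat.mul_le_mul_right _ he
    omega

theorem card_separator_ge (h : IsLayeredSeparation m e near K C D) :
    (e + 1) * m ≤ K.card ∧ (1 ≤ e → 2 ≤ C.card → 2 ≤ D.card → (e + 1) * m + 1 ≤ K.card) := by
  by_cases hl : ∀ i x y, (x, i) ∈ C → (y, i) ∉ D
  · by_cases hc : ∀ x i j, (x, i) ∈ C → (x, j) ∉ D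
    · exact h.le_card_of_unmixed hl hc
    · push Not at hc
      obtain ⟨x, i, j, hi, hj⟩ := hc
      have := h.le_card_of_mixed_column hl hi hj
      tauto
  · push Not at hl
    obtain ⟨i₀, x₀, y₀, hx₀, hy₀⟩ := hl
    by_cases hl : ∀ i ≠ i₀, ∀ x y, (x, i) ∈ C → (y, i) ∉ D
    · have := h.le_card_of_one_mixed_layer hx₀ hy₀ hl
      tauto
    · push Not at hl
      obtain ⟨i₁, hne, x₁, y₁, hx₁, hy₁⟩ := hl
      have := h.le_card_of_two_mixed_layers hne.symm hx₀ hy₀ hx₁ hy₁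
      exact ⟨by omega, fun _ _ _ => this⟩

end IsLayeredSeparation
end Layers

/-! ### Isoperimetry of the hypergrid -/

section Lines

/-- In a line, two sets without points in range of each other are separated by at least `ω - 1`
consecutive points, and `ω + 1` points are needed for that. -/
theorem exists_gap_of_lt {n ω : ℕ} : ∀ (l : ℕ) {P Q : Fin n → Prop}
    (_ : ∀ i j : Fin n, |((i : ℕ) : ℤ) - ((j : ℕ) : ℤ)| < (ω : ℤ) → P i → ¬ Q j)
    {i j : Fin n}, P i → Q j → (i : ℕ) < j → (j : ℕ) - i = l →
    ω + 1 ≤ n ∧ ∃ B : Finset (Fin n), ω - 1 ≤ B.card ∧ ∀ k ∈ B, ¬ P k ∧ ¬ Q k := by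
  intro l
  induction l using Nat.strong_induction_on with
  | _ l ih =>
    intro P Q h i j hi hj hij hl
    by_cases hex : ∃ k ∈ Finset.Ioo i j, P k ∨ Q k
    · obtain ⟨k, hk, hPQ⟩ := hex
      rw [Finset.mem_Ioo, Fin.lt_def, Fin.lt_def] at hk
      rcases hPQ with hk' | hk'
      · exact ih (j - k) (by omega) h hk' hj hk.2 rfl
      · exact ih (k - i) (by omega) h hi hk' hk.1 rfl
    · push Not at hex
      have hfar : (ω : ℤ) ≤ |((i : ℕ) : ℤ) - ((j : ℕ) : ℤ)| := by
        by_contra! hlt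
        exact h i j hlt hi hj
      rw [abs_sub_comm, abs_of_nonneg (by omega)] at hfar
      have hjn := j.2
      refine ⟨by omega, Finset.Ioo i j, ?_, hex⟩
      rw [Fin.card_Ioo]
      omega

theorem exists_gap {n ω : ℕ} (hω : 0 < ω) {P Q : Fin n → Prop}
    (h : ∀ i j : Fin n, |((i : ℕ) : ℤ) - ((j : ℕ) : ℤ)| < (ω : ℤ) → P i → ¬ Q j)
    {i j : Fin n} (hi : P i) (hj : Q j) :
    ω + 1 ≤ n ∧ ∃ B : Finset (Fin n), ω - 1 ≤ B.card ∧ ∀ k ∈ B, ¬ P k ∧ ¬ Q k := by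
  rcases lt_trichotomy (i : ℕ) j with hij | hij | hij
  · exact exists_gap_of_lt _ h hi hj hij rfl
  · exact absurd hj (h i j (by rw [hij]; simpa using hω) hi)
  · obtain ⟨h1, B, hB, hB'⟩ := exists_gap_of_lt _
      (fun a b hab hQ hP => h b a (by rwa [abs_sub_comm]) hP hQ) hj hi hij rfl
    exact ⟨h1, B, hB, fun k hk => (hB' k hk).symm⟩

/-- Every point of a line has at least `min n ω - 1` other points in range. -/
theorem exists_window {n ω : ℕ} (i : Fin n) : ∃ w : Finset (Fin n), i ∉ w ∧ min n ω - 1 ≤ w.card ∧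
    ∀ j ∈ w, |((i : ℕ) : ℤ) - ((j : ℕ) : ℤ)| < (ω : ℤ) := by
  rcases Nat.eq_zero_or_pos ω with rfl | hω
  · exact ⟨∅, by simp⟩
  have hi := i.2
  let a : ℕ := min i (n - min n ω)
  refine ⟨(Finset.Icc (⟨a, by omega⟩ : Fin n) ⟨a + (min n ω - 1), by omega⟩).erase i, by simp,
    ?_, ?_⟩
  · rw [Finset.card_erase_of_mem, Fin.card_Icc]
    · simp only
      omega
    · rw [Finset.mem_Icc, Fin.le_def, Fin.le_def]
      simp only
      omega
  · intro j hj
    have := Finset.mem_of_mem_erase hj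
    rw [Finset.mem_Icc, Fin.le_def, Fin.le_def] at this
    simp only at this
    rw [abs_lt]
    omega

end Lines

section Sight

variable {d n ω : ℕ}

theorem inSight_cons_of_near {i j : Fin n} (hij : i ≠ j)
    (h : |((i : ℕ) : ℤ) - ((j : ℕ) : ℤ)| < (ω : ℤ)) (x : Fin d → Fin n) :
    InSight ω (Fin.cons i x : Fin (d + 1) → Fin n) (Fin.cons j x : Fin (d + 1) → Fin n) := by
  refine ⟨0, by simpa using hij, fun k => ?_, by simpa using h⟩
  refine Fin.cases (fun h => absurd rfl h) (fun k _ => ?_) k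
  simp

theorem InSight.cons {x y : Fin d → Fin n} (h : InSight ω x y) (i : Fin n) :
    InSight ω (Fin.cons i x : Fin (d + 1) → Fin n) (Fin.cons i y : Fin (d + 1) → Fin n) := by
  obtain ⟨k, hk, hk', hkω⟩ := h
  refine ⟨k.succ, by simpa using hk, fun l => ?_, by simpa using hkω⟩
  refine Fin.cases (fun _ => by simp) (fun l hl => ?_) l
  simpa using hk' l (fun e => hl (e ▸ rfl))

theorem inSight_update {x : Fin d → Fin n} {i : Fin d} {t : Fin n} (ht : t ≠ x i)
    (h : |((x i : ℕ) : ℤ) - ((t : ℕ) : ℤ)| < (ω : ℤ)) : InSight ω x (Function.update x i t) :=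
  ⟨i, by simpa using ht.symm, fun j hj => by simp [hj], by simpa using h⟩

theorem InSight.eq_update {x y : Fin d → Fin n} (h : InSight ω x y) : ∃ i, y i ≠ x i ∧
    |((x i : ℕ) : ℤ) - ((y i : ℕ) : ℤ)| < (ω : ℤ) ∧ y = Function.update x i (y i) := by
  obtain ⟨i, h1, h2, h3⟩ := h
  refine ⟨i, h1.symm, h3, ?_⟩
  funext j
  by_cases hj : j = i
  · subst hj; simp
  · simp [hj, h2 j hj]

open Classical in
theorem card_inSight_le (x : Fin d → Fin n) (b : ℕ)
    (hb : ∀ i, (Finset.univ.filter fun t : Fin n => t ≠ x i ∧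
      |((x i : ℕ) : ℤ) - ((t : ℕ) : ℤ)| < (ω : ℤ)).card ≤ b) :
    (Finset.univ.filter fun y => InSight ω x y).card ≤ d * b := by
  have hsub : (Finset.univ.filter fun y => InSight ω x y) ⊆ Finset.univ.biUnion fun i =>
      (Finset.univ.filter fun t : Fin n => t ≠ x i ∧
        |((x i : ℕ) : ℤ) - ((t : ℕ) : ℤ)| < (ω : ℤ)).image (Function.update x i) := by
    intro y hy
    obtain ⟨i, h1, h2, h3⟩ := (Finset.mem_filter.1 hy).2.eq_update
    exact Finset.mem_biUnion.2 ⟨i, Finset.mem_univ _, Finset.mem_image.2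
      ⟨y i, Finset.mem_filter.2 ⟨Finset.mem_univ _, h1, h2⟩, h3.symm⟩⟩
  refine (Finset.card_le_card hsub).trans ?_
  refine (Finset.card_biUnion_le_card_mul _ _ b fun i _ => ?_).trans (by simp)
  exact Finset.card_image_le.trans (hb i)

theorem card_near_le (hω : 0 < ω) (s : Fin n) : (Finset.univ.filter fun t : Fin n => t ≠ s ∧
    |((s : ℕ) : ℤ) - ((t : ℕ) : ℤ)| < (ω : ℤ)).card ≤ 2 * (ω - 1) := by
  have h : ((Finset.Ioo (-(ω : ℤ)) ω).erase 0).card = 2 * (ω - 1) := by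
    rw [Finset.card_erase_of_mem (by simp; omega), Int.card_Ioo]
    omega
  rw [← h]
  refine Finset.card_le_card_of_injOn (fun t => ((s : ℕ) : ℤ) - ((t : ℕ) : ℤ)) ?_ ?_
  · intro t ht
    obtain ⟨-, h1, h2⟩ := Finset.mem_filter.1 ht
    rw [abs_lt] at h2
    simp only [Finset.coe_erase, Finset.coe_Ioo, Set.mem_sdiff, Set.mem_Ioo, Set.mem_singleton_iff]
    exact ⟨h2, fun h0 => h1 (Fin.ext (by omega))⟩
  · intro t _ t' _ h
    simp only at h
    exact Fin.ext (by omega)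

theorem card_near_zero_le {s : Fin n} (hs : (s : ℕ) = 0) :
    (Finset.univ.filter fun t : Fin n => t ≠ s ∧
      |((s : ℕ) : ℤ) - ((t : ℕ) : ℤ)| < (ω : ℤ)).card ≤ min n ω - 1 := by
  have h : (Finset.Ioo 0 (min n ω)).card = min n ω - 1 := by rw [Nat.card_Ioo]; omega
  rw [← h]
  refine Finset.card_le_card_of_injOn (fun t => (t : ℕ)) ?_ fun t _ t' _ h => Fin.ext h
  intro t ht
  obtain ⟨-, h1, h2⟩ := Finset.mem_filter.1 ht
  rw [abs_lt] at h2
  have h3 : (t : ℕ) ≠ s := fun e => h1 (Fin.ext e)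
  have := t.2
  simp only [Finset.coe_Ioo, Set.mem_Ioo]
  omega

end Sight

section Hypergrid

theorem one_add_mul_pred_le_pow (n e : ℕ) (hn : 2 ≤ n) : 1 + e * (n - 1) ≤ n ^ e := by
  obtain ⟨k, rfl⟩ : ∃ k, n = k + 1 := ⟨n - 1, by omega⟩
  induction e with
  | zero => simp
  | succ e ih =>
    rw [pow_succ]
    simp only [Nat.add_sub_cancel] at ih ⊢
    nlinarith [Nat.zero_le (e * k * k)]

theorem two_add_mul_pred_le_pow (n e : ℕ) (hn : 2 ≤ n) (he : 2 ≤ e) : 2 + e * (n - 1) ≤ n ^ e := by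
  obtain ⟨e, rfl⟩ : ∃ k, e = k + 1 := ⟨e - 1, by omega⟩
  have := one_add_mul_pred_le_pow n e hn
  obtain ⟨k, rfl⟩ : ∃ k, n = k + 1 := ⟨n - 1, by omega⟩
  rw [pow_succ]
  simp only [Nat.add_sub_cancel] at this ⊢
  have h1 : 1 * 1 ≤ e * (k * k) := Nat.mul_le_mul (by omega) (Nat.mul_pos (by omega) (by omega))
  nlinarith

/-- A map of the points of a line into the cube that preserves being in range. -/
def IsSightLine {d : ℕ} (n ω : ℕ) (g : Fin n → (Fin d → Fin n)) : Prop :=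
  ∀ i j : Fin n, i ≠ j → |((i : ℕ) : ℤ) - ((j : ℕ) : ℤ)| < (ω : ℤ) → InSight ω (g i) (g j)

theorem IsSeparation.notMem_of_near {d n ω : ℕ} {K C D : Finset (Fin d → Fin n)}
    (h : IsSeparation (hypergrid n d ω) K C D) {g : Fin n → (Fin d → Fin n)}
    (hg : IsSightLine n ω g) (i j : Fin n) (hij : |((i : ℕ) : ℤ) - ((j : ℕ) : ℤ)| < (ω : ℤ))
    (hi : g i ∈ C) : g j ∉ D := by
  intro hj
  by_cases hne : i = j
  · subst hne
    exact h.disjoint _ hi hj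
  · exact h.not_adj _ hi _ hj (hg i j hne hij)

theorem IsSeparation.exists_gap {d n ω : ℕ} (hω : 0 < ω) {K C D : Finset (Fin d → Fin n)}
    (h : IsSeparation (hypergrid n d ω) K C D) {g : Fin n → (Fin d → Fin n)}
    (hg : IsSightLine n ω g) {i j : Fin n} (hi : g i ∈ C) (hj : g j ∈ D) :
    ω + 1 ≤ n ∧ ∃ B : Finset (Fin n), ω - 1 ≤ B.card ∧ ∀ k ∈ B, g k ∈ K := by
  obtain ⟨h1, B, hB, hB'⟩ := Tomography.exists_gap (P := fun i => g i ∈ C) (Q := fun i => g i ∈ D)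
    hω (h.notMem_of_near hg) hi hj
  refine ⟨h1, B, hB, fun k hk => ?_⟩
  have h2 := hB' k hk
  have h3 := h.cover (g k)
  tauto

theorem isSightLine_cons {d n ω : ℕ} (x : Fin d → Fin n) :
    IsSightLine n ω fun i => (Fin.cons i x : Fin (d + 1) → Fin n) :=
  fun _ _ hne hij => inSight_cons_of_near hne hij x

theorem isSightLine_cons_const {n ω : ℕ} (i : Fin n) :
    IsSightLine n ω fun t => (Fin.cons i (fun _ => t) : Fin (1 + 1) → Fin n) := by
  intro t t' hne ht
  have h : InSight ω (fun _ : Fin 1 => t) (fun _ => t') :=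
    ⟨0, hne, fun k hk => absurd (Subsingleton.elim k 0) hk, ht⟩
  exact h.cons i

theorem IsSeparation.layer {e n ω : ℕ} {K C D : Finset (Fin (e + 1) → Fin n)}
    (h : IsSeparation (hypergrid n (e + 1) ω) K C D) {i : Fin n} {x y : Fin e → Fin n}
    (hx : (Fin.cons i x : Fin (e + 1) → Fin n) ∈ C)
    (hy : (Fin.cons i y : Fin (e + 1) → Fin n) ∈ D) :
    IsSeparation (hypergrid n e ω)
      (Finset.univ.filter fun z => (Fin.cons i z : Fin (e + 1) → Fin n) ∈ K)
      (Finset.univ.filter fun z => (Fin.cons i z : Fin (e + 1) → Fin n) ∈ C)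
      (Finset.univ.filter fun z => (Fin.cons i z : Fin (e + 1) → Fin n) ∈ D) := by
  refine ⟨⟨x, by simpa using hx⟩, ⟨y, by simpa using hy⟩, ?_, ?_, ?_, ?_, ?_⟩ <;>
    simp only [Finset.mem_filter, Finset.mem_univ, true_and]
  · exact fun z => h.cover _
  · exact fun z => h.disjoint _
  · exact fun z => h.left_notMem _
  · exact fun z => h.right_notMem _
  · exact fun u hu v hv huv => h.not_adj _ hu _ hv (InSight.cons huv i)

/-- Being in range among the points of a line. -/
def Near {n : ℕ} (ω : ℕ) (i j : Fin n) : Prop := |((i : ℕ) : ℤ) - ((j : ℕ) : ℤ)| < (ω : ℤ)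

/-- The identification of the cube with its layers, perpendicular to the first axis. -/
def layerEquiv (n e : ℕ) : (Fin e → Fin n) × Fin n ≃ (Fin (e + 1) → Fin n) :=
  (Equiv.prodComm _ _).trans (Fin.consEquiv fun _ => Fin n)

theorem mem_map_layerEquiv {n e : ℕ} (E : Finset (Fin (e + 1) → Fin n)) (x : Fin e → Fin n)
    (i : Fin n) : (x, i) ∈ E.map (layerEquiv n e).symm.toEmbedding ↔
      (Fin.cons i x : Fin (e + 1) → Fin n) ∈ E := by
  rw [Finset.mem_map_equiv, Equiv.symm_symm]
  rfl

theorem IsSeparation.isLayeredSeparation {n ω e : ℕ} (hn : 2 ≤ n) (hω : 2 < ω)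
    (ih : ∀ {K C D : Finset (Fin e → Fin n)}, IsSeparation (hypergrid n e ω) K C D →
      e * (min n ω - 1) ≤ K.card)
    {K C D : Finset (Fin (e + 1) → Fin n)} (h : IsSeparation (hypergrid n (e + 1) ω) K C D) :
    IsLayeredSeparation (min n ω - 1) e (Near ω) (K.map (layerEquiv n e).symm.toEmbedding)
      (C.map (layerEquiv n e).symm.toEmbedding) (D.map (layerEquiv n e).symm.toEmbedding) where
  left_nonempty := h.left_nonempty.map
  right_nonempty := h.right_nonempty.map
  cover := by
    rintro ⟨x, i⟩
    simp only [mem_map_layerEquiv]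
    exact h.cover _
  disjoint := by
    rintro ⟨x, i⟩
    simp only [mem_map_layerEquiv]
    exact h.disjoint _
  near_symm i j hij := by
    unfold Near at hij ⊢
    rwa [abs_sub_comm]
  not_near x i j hij := by
    simp only [mem_map_layerEquiv]
    exact h.notMem_of_near (isSightLine_cons x) i j hij
  window := exists_window
  column x i j hi hj := by
    rw [mem_map_layerEquiv] at hi hj
    obtain ⟨h1, B, hB, hB'⟩ := h.exists_gap (by omega) (isSightLine_cons x) hi hj
    refine ⟨by omega, by omega, (by omega : min n ω - 1 ≤ B.card).trans ?_⟩
    refine Finset.card_le_card_of_injOn (fun k => (x, k)) (fun k hk => ?_)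
      (fun k _ k' _ hkk => (Prod.mk.inj hkk).2)
    exact Finset.mem_filter.2 ⟨(mem_map_layerEquiv _ _ _).2 (hB' k hk), rfl⟩
  layer i x y hx hy := by
    rw [mem_map_layerEquiv] at hx hy
    refine ⟨?_, ?_, ?_⟩
    · rw [Nat.one_le_iff_ne_zero]
      rintro rfl
      exact h.disjoint _ hx (Subsingleton.elim y x ▸ hy)
    · rintro rfl
      have hc : ∀ z : Fin 1 → Fin n, z = fun _ => z 0 := fun z => by
        funext k; rw [Subsingleton.elim k 0]
      rw [hc x] at hx
      rw [hc y] at hy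
      have := (h.exists_gap (by omega) (isSightLine_cons_const i) hx hy).1
      omega
    · refine (ih (h.layer hx hy)).trans (Finset.card_le_card_of_injOn (fun z => (z, i))
        (fun z hz => ?_) (fun k _ k' _ hkk => (Prod.mk.inj hkk).1))
      exact Finset.mem_filter.2 ⟨(mem_map_layerEquiv _ _ _).2 (Finset.mem_filter.1 hz).2, rfl⟩
  one_le := by omega
  lt := by omega
  le_card := by simpa using one_add_mul_pred_le_pow n e hn
  lt_card he := by simpa using two_add_mul_pred_le_pow n e hn he
  card_eq := by
    rintro rfl
    simp

/-- The vertex-isoperimetry of the hypergrid: a separator has at least `d * (min n ω - 1)` elements,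
with equality only if one side of it is a single point, apart from the one-dimensional case. -/
theorem IsSeparation.card_hypergrid {n ω : ℕ} (hn : 2 ≤ n) (hω : 2 < ω) : ∀ {d : ℕ}
    {K C D : Finset (Fin d → Fin n)}, IsSeparation (hypergrid n d ω) K C D →
    d * (min n ω - 1) ≤ K.card ∧
      (2 ≤ d → 2 ≤ C.card → 2 ≤ D.card → d * (min n ω - 1) + 1 ≤ K.card) := by
  intro d
  induction d with
  | zero => intro K C D _; simp
  | succ e ih =>
    intro K C D h
    have := (h.isLayeredSeparation hn hω fun h => (ih h).1).card_separator_ge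
    simp only [Finset.card_map] at this
    exact ⟨this.1, fun he => this.2 (by omega)⟩

theorem le_vertexConnectivity_hypergrid {n ω d : ℕ} (hn : 2 ≤ n) (hω : 2 < ω) :
    d * (min n ω - 1) ≤ vertexConnectivity (hypergrid n d ω) := by
  classical
  obtain ⟨K, hK, h⟩ := exists_card_eq_vertexConnectivity (hypergrid n d ω)
  rw [← hK]
  rcases h with h | h
  · obtain ⟨C, D, h⟩ := exists_isSeparation h
    exact (h.card_hypergrid hn hω).1
  · have h1 : (Kᶜ).card ≤ 1 := Finset.card_le_one.2 fun a ha b hb =>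
      h (by simpa using ha) (by simpa using hb)
    have h2 := Finset.card_add_card_compl K
    have h3 := one_add_mul_pred_le_pow n d hn
    have h4 : d * (min n ω - 1) ≤ d * (n - 1) := Nat.mul_le_mul_left _ (by omega)
    simp only [Fintype.card_pi, Fintype.card_fin, Finset.prod_const, Finset.card_univ] at h2
    omega

end Hypergrid

/-! ### Monitor placements of Line-of-Sight networks -/

section Blocked

variable {V : Type*} {G : SimpleGraph V}

theorem IsSeparation.vertexConnectivity_le [Fintype V] {K C D : Finset V} (h : IsSeparation G K C D) :
    vertexConnectivity G ≤ K.card := by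
  by_contra! hlt
  obtain ⟨a, ha⟩ := h.left_nonempty
  obtain ⟨b, hb⟩ := h.right_nonempty
  obtain ⟨p, -, hp⟩ := exists_isPath_avoiding hlt (h.left_notMem a ha) (h.right_notMem b hb)
  exact h.disjoint b (h.mem_of_walk p ha hp) hb

/-- The subgraph in which the vertices of `U` are isolated. -/
def isolate (G : SimpleGraph V) (U : Finset V) : SimpleGraph V where
  Adj a b := G.Adj a b ∧ a ∉ U ∧ b ∉ U
  symm := ⟨fun _ _ h => ⟨h.1.symm, h.2.2, h.2.1⟩⟩
  loopless := ⟨fun _ h => G.loopless.irrefl _ h.1⟩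

theorem notMem_of_mem_support_isolate {U : Finset V} {a b : V} (p : (isolate G U).Walk a b)
    (ha : a ∉ U) : ∀ v ∈ p.support, v ∉ U := by
  induction p with
  | nil => simpa using ha
  | cons h p ih =>
    intro v hv
    rw [SimpleGraph.Walk.support_cons, List.mem_cons] at hv
    rcases hv with rfl | hv
    · exact ha
    · exact ih h.2.2 v hv

theorem reachable_isolate {U : Finset V} {a b : V} (p : G.Walk a b) (hp : ∀ v ∈ p.support, v ∉ U) :
    (isolate G U).Reachable a b := by
  induction p with
  | nil => rfl
  | @cons a c b h p ih =>
    have hadj : (isolate G U).Adj a c := ⟨h, hp a (by simp), hp c (by simp)⟩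
    exact hadj.reachable.trans (ih fun v hv => hp v (by simp [hv]))

/-- If the failure of `w` cannot be detected when the vertices of `U` have failed, then `U`
together with a single further vertex separates `w` from all monitors. -/
theorem exists_isPath_or_isSeparation [Fintype V] {S T U : Finset V} (hU : U.card < vertexConnectivity G)
    {w : V} (hw : w ∉ U) (hS : ∃ s ∈ S, s ∉ U) (hT : ∃ t ∈ T, t ∉ U)
    (hST : ∀ x, ∃ z, (z ∈ S ∨ z ∈ T) ∧ z ∉ U ∧ z ≠ x) :
    (∃ s ∈ S, ∃ t ∈ T, ∃ p : G.Walk s t, p.IsPath ∧ w ∈ p.support ∧ ∀ v ∈ p.support, v ∉ U) ∨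
    ∃ K C D, IsSeparation G K C D ∧ U ⊆ K ∧ K.card ≤ U.card + 1 ∧ w ∈ C ∧
      ∀ z, z ∈ S ∨ z ∈ T → z ∉ C := by
  classical
  have hreach : ∀ z ∉ U, (isolate G U).Reachable w z := fun z hz => by
    obtain ⟨p, -, hp⟩ := exists_isPath_avoiding hU hw hz
    exact reachable_isolate p hp
  by_cases hsep : ∀ x ≠ w, ∃ z ∈ {z | z ∈ S ∧ z ∉ U} ∪ {z | z ∈ T ∧ z ∉ U},
      ∃ q : (isolate G U).Walk w z, x ∉ q.support
  · left
    obtain ⟨s, hs, hsU⟩ := hS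
    obtain ⟨t, ht, htU⟩ := hT
    obtain ⟨a, ⟨haS, haU⟩, b, ⟨hbT, -⟩, p, hp, hwp⟩ := exists_isPath_through
      {z | z ∈ S ∧ z ∉ U} {z | z ∈ T ∧ z ∉ U} w ⟨s, ⟨hs, hsU⟩, hreach s hsU⟩
      ⟨t, ⟨ht, htU⟩, hreach t htU⟩ hsep
    have hle : isolate G U ≤ G := fun _ _ h => h.1
    refine ⟨a, haS, b, hbT, p.mapLe hle, hp.mapLe hle, ?_, ?_⟩
    · rwa [SimpleGraph.Walk.support_mapLe_eq_support]
    · rw [SimpleGraph.Walk.support_mapLe_eq_support]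
      exact notMem_of_mem_support_isolate p haU
  · right
    push Not at hsep
    obtain ⟨x, hxw, hx⟩ := hsep
    let C : Finset V := Finset.univ.filter fun v => ∃ q : (isolate G U).Walk w v, x ∉ q.support
    let D : Finset V := Finset.univ.filter fun v => v ∉ C ∧ v ∉ insert x U
    have hC : ∀ v, v ∈ C ↔ ∃ q : (isolate G U).Walk w v, x ∉ q.support := fun v => by simp [C]
    have hD : ∀ v, v ∈ D ↔ v ∉ C ∧ v ∉ insert x U := fun v => by simp [D]
    have hCK : ∀ v ∈ C, v ∉ insert x U := by
      intro v hv
      obtain ⟨q, hq⟩ := (hC v).1 hv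
      rw [Finset.mem_insert, not_or]
      exact ⟨fun e => hq (e ▸ q.end_mem_support),
        notMem_of_mem_support_isolate q hw v q.end_mem_support⟩
    have hmon : ∀ z, z ∈ S ∨ z ∈ T → z ∉ C := by
      intro z hz hzC
      obtain ⟨q, hq⟩ := (hC z).1 hzC
      have hzU : z ∉ U := fun h => hCK z hzC (Finset.mem_insert_of_mem h)
      exact hq (hx z (hz.imp (⟨·, hzU⟩) (⟨·, hzU⟩)) q)
    have hwC : w ∈ C := (hC w).2 ⟨.nil, by simpa using hxw⟩
    refine ⟨insert x U, C, D, ⟨⟨w, hwC⟩, ?_, ?_, ?_, hCK, ?_, ?_⟩, Finset.subset_insert _ _,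
      Finset.card_insert_le _ _, hwC, hmon⟩
    · obtain ⟨z, hz, hzU, hzx⟩ := hST x
      exact ⟨z, (hD z).2 ⟨hmon z hz, by simp [hzU, hzx]⟩⟩
    · intro v
      rw [hD]
      tauto
    · exact fun v hv hv' => ((hD v).1 hv').1 hv
    · exact fun v hv => ((hD v).1 hv).2
    · intro u hu v hv huv
      obtain ⟨hvC, hvK⟩ := (hD v).1 hv
      have huK := hCK u hu
      obtain ⟨q, hq⟩ := (hC u).1 hu
      rw [Finset.mem_insert, not_or] at hvK huK
      have hadj : (isolate G U).Adj u v := ⟨huv, huK.2, hvK.2⟩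
      refine hvC ((hC v).2 ⟨q.concat hadj, ?_⟩)
      rw [SimpleGraph.Walk.support_concat]
      simp [hq, Ne.symm hvK.1]

end Blocked

section Monitors

variable {d n ω : ℕ}

open Classical in
/-- The points in sight and in range of `x`, that is, its neighbours in the hypergrid. -/
noncomputable def visible (ω : ℕ) (x : Fin d → Fin n) : Finset (Fin d → Fin n) :=
  Finset.univ.filter fun y => InSight ω x y

theorem mem_visible {x y : Fin d → Fin n} : y ∈ visible ω x ↔ InSight ω x y := by
  simp [visible]

theorem vertexConnectivity_hypergrid_le (x : Fin d → Fin n) :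
    vertexConnectivity (hypergrid n d ω) ≤ (visible ω x).card :=
  vertexConnectivity_le_card_of_neighbors x _ fun _ => mem_visible

theorem card_visible_corner {x : Fin d → Fin n} (hx : ∀ i, (x i : ℕ) = 0) :
    (visible ω x).card ≤ d * (min n ω - 1) :=
  card_inSight_le x _ fun i => card_near_zero_le (hx i)

theorem vertexConnectivity_hypergrid (hn : 2 ≤ n) (hω : 2 < ω) :
    vertexConnectivity (hypergrid n d ω) = d * (min n ω - 1) :=
  le_antisymm ((vertexConnectivity_hypergrid_le fun _ => ⟨0, by omega⟩).trans
    (card_visible_corner fun _ => rfl)) (le_vertexConnectivity_hypergrid hn hω)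

/-- Every vertex lies on a monitoring path, as the hypergrid is 2-connected or has two vertices. -/
theorem mem_usedVertices_hypergrid (hd : 0 < d) (hn : 2 ≤ n) (hω : 2 < ω)
    {S T : Finset (Fin d → Fin n)} (hST : IsMonitorPlacement S T) (w : Fin d → Fin n) :
    w ∈ usedVertices (hypergrid n d ω) S T := by
  obtain ⟨hS, hT, hdisj⟩ := hST
  have hκ := vertexConnectivity_hypergrid (d := d) hn hω
  have hκ0 : 0 < vertexConnectivity (hypergrid n d ω) := by
    rw [hκ]
    exact Nat.mul_pos hd (by omega)
  rcases Nat.lt_or_ge 1 (vertexConnectivity (hypergrid n d ω)) with h1 | h1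
  · obtain ⟨s, hs⟩ := hS
    obtain ⟨t, ht⟩ := hT
    have hst : s ≠ t := fun e => Finset.disjoint_left.1 hdisj hs (e ▸ ht)
    rcases exists_isPath_or_isSeparation (U := ∅) (w := w) hκ0 (by simp) ⟨s, hs, by simp⟩
      ⟨t, ht, by simp⟩ (fun x => by
        by_cases hx : s = x
        · exact ⟨t, Or.inr ht, by simp, fun e => hst (hx.trans e.symm)⟩
        · exact ⟨s, Or.inl hs, by simp, hx⟩) with
      ⟨a, ha, b, hb, p, hp, hwp, -⟩ | ⟨K, C, D, h, -, hK, -⟩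
    · exact mem_usedVertices_iff.2 ⟨a, ha, b, hb, p, hp, hwp⟩
    · have := h.vertexConnectivity_le
      simp only [Finset.card_empty] at hK
      omega
  · have h2 : d * (min n ω - 1) = 1 := by omega
    obtain ⟨rfl, h3⟩ := mul_eq_one.1 h2
    obtain rfl : n = 2 := by omega
    have hcard := Finset.card_union_of_disjoint hdisj
    have hS1 := Finset.card_pos.2 hS
    have hT1 := Finset.card_pos.2 hT
    have huniv : S ∪ T = Finset.univ := by
      rw [← Finset.card_eq_iff_eq_univ]
      refine le_antisymm (Finset.card_le_univ _) ?_
      simp only [Fintype.card_pi, Fintype.card_fin, Finset.prod_const, Finset.card_univ]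
      omega
    have hw : w ∈ S ∪ T := huniv ▸ Finset.mem_univ w
    exact mem_usedVertices_of_mem hκ0 hS hT (Finset.mem_union.1 hw)

theorem maxIdentifiability_hypergrid_le (hd : 0 < d) (hn : 2 ≤ n) (hω : 2 < ω)
    {S T : Finset (Fin d → Fin n)} (hST : IsMonitorPlacement S T) :
    maxIdentifiability (hypergrid n d ω) S T ≤ vertexConnectivity (hypergrid n d ω) := by
  let c : Fin d → Fin n := fun _ => ⟨0, by omega⟩
  rw [vertexConnectivity_hypergrid hn hω]
  refine (maxIdentifiability_le_card (K := visible ω c)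
    (mem_usedVertices_hypergrid hd hn hω hST c) ?_ ?_).trans (card_visible_corner fun _ => rfl)
  · rw [mem_visible]
    exact (hypergrid n d ω).loopless.irrefl c
  · intro s hs t ht p hp hcp
    have hst : s ≠ t := fun e => Finset.disjoint_left.1 hST.2.2 hs (e ▸ ht)
    obtain ⟨u, hu, hcu⟩ := exists_adj_mem_support hst p hcp
    exact ⟨u, mem_visible.2 hcu, hu⟩

/-- Among `U` and `W` of size less than `κ`, a point `w` of `W` outside `U` separates them unless `U`
consists of all but one of the neighbours of `w`, which is a vertex of minimum degree. -/
theorem separable_or_eq_visible (hd : 2 ≤ d) (hn : 2 ≤ n) (hω : 2 < ω)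
    {S T : Finset (Fin d → Fin n)} (hdisj : Disjoint S T) (hS : S.card = d * ω - 1)
    (hT : T.card = d * ω - 1) {U W : Finset (Fin d → Fin n)} (hU : U.card < d * (min n ω - 1))
    {w : Fin d → Fin n} (hwW : w ∈ W) (hwU : w ∉ U) :
    Separable (hypergrid n d ω) S T U W ∨ (U ⊆ visible ω w ∧
      (visible ω w).card = d * (min n ω - 1) ∧ U.card + 1 = d * (min n ω - 1)) := by
  have hκ := vertexConnectivity_hypergrid (d := d) hn hω
  have hUκ : U.card < vertexConnectivity (hypergrid n d ω) := by rwa [hκ]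
  have hm : d * (min n ω - 1) + d ≤ d * ω := by
    rw [← Nat.mul_succ]
    exact Nat.mul_le_mul_left _ (by omega)
  have hdω : d * 3 ≤ d * ω := Nat.mul_le_mul_left _ hω
  have hout : ∀ {E F : Finset (Fin d → Fin n)}, E.card < F.card → ∃ z ∈ F, z ∉ E :=
    fun h => Finset.exists_mem_notMem_of_card_lt_card h
  obtain ⟨s, hs, hsU⟩ := hout (by omega : U.card < S.card)
  obtain ⟨t, ht, htU⟩ := hout (by omega : U.card < T.card)
  have hcard := Finset.card_union_of_disjoint hdisj
  by_cases hwS : w ∈ S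
  · exact Or.inl (separable_of_mem_left hUκ hwW hwU hwS ht htU)
  by_cases hwT : w ∈ T
  · exact Or.inl (separable_of_mem_right hUκ hwW hwU hwT hs hsU)
  rcases exists_isPath_or_isSeparation hUκ hwU ⟨s, hs, hsU⟩ ⟨t, ht, htU⟩ (fun x => by
      obtain ⟨z, hz, hz'⟩ := hout (E := insert x U) (F := S ∪ T)
        ((Finset.card_insert_le _ _).trans_lt (by omega))
      rw [Finset.mem_insert, not_or] at hz'
      exact ⟨z, Finset.mem_union.1 hz, hz'.2, hz'.1⟩) with
    ⟨a, ha, b, hb, p, hp, hwp, hpU⟩ | ⟨K, C, D, h, hUK, hK, hwC, hC⟩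
  · exact Or.inl (separable_of_isPath ha hb p hp hwp hwW hpU)
  · right
    have hiso := h.card_hypergrid hn hω
    -- The monitors outside `K` all lie in `D`, which therefore is not a single point.
    have hD : 2 ≤ D.card := by
      have h1 : (S ∪ T).card ≤ D.card + K.card := by
        refine (Finset.card_le_card fun z hz => ?_).trans (Finset.card_union_le D K)
        have h2 := hC z (Finset.mem_union.1 hz)
        have h3 := h.cover z
        rw [Finset.mem_union]
        tauto
      omega
    have hC1 : C.card ≤ 1 := by
      by_contra! hC2
      have := hiso.2 hd hC2 hD
      omega
    have hvK : visible ω w ⊆ K := by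
      intro y hy
      rw [mem_visible] at hy
      rcases h.cover y with h3 | h3 | h3
      · rw [Finset.card_le_one.1 hC1 y h3 w hwC] at hy
        exact absurd hy ((hypergrid n d ω).loopless.irrefl w)
      · exact absurd hy (h.not_adj w hwC y h3)
      · exact h3
    have hvκ := vertexConnectivity_hypergrid_le (ω := ω) w
    have heq : visible ω w = K := Finset.eq_of_subset_of_card_le hvK (by omega)
    exact ⟨heq ▸ hUK, heq ▸ by omega, by omega⟩

theorem InSight.eq_of_ne {x y : Fin d → Fin n} (h : InSight ω x y) {i j : Fin d} (hi : x i ≠ y i)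
    (hj : x j ≠ y j) : i = j := by
  obtain ⟨k, -, hk, -⟩ := h
  have h1 : i = k := by
    by_contra hne
    exact hi (hk i hne)
  have h2 : j = k := by
    by_contra hne
    exact hj (hk j hne)
  exact h1.trans h2.symm

/-- Two points that differ in the coordinates `i` and `j` have at most two common neighbours. -/
theorem eq_or_eq_of_inSight {x y z : Fin d → Fin n} {i j : Fin d} (hij : i ≠ j) (hi : x i ≠ y i)
    (hj : x j ≠ y j) (hx : InSight ω x z) (hy : InSight ω y z) :
    z = Function.update x i (y i) ∨ z = Function.update x j (y j) := by
  have hoff : ∀ {a b : Fin d}, a ≠ b → x a ≠ y a → x b ≠ y b → z a ≠ x a →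
      z = Function.update x a (y a) := by
    intro a b hab ha hb hza
    have h1 : z b = x b := by
      by_contra hne
      exact hab (hx.eq_of_ne (Ne.symm hza) (Ne.symm hne))
    have h2 : z a = y a := by
      by_contra hne
      exact hab (hy.eq_of_ne (Ne.symm hne) (by rw [h1]; exact hb.symm))
    funext k
    by_cases hk : k = a
    · subst hk
      simpa using h2
    · rw [Function.update_of_ne hk]
      by_contra hne
      exact hk (hx.eq_of_ne (Ne.symm hne) (Ne.symm hza))
  by_cases hzi : z i = x i
  · refine Or.inr (hoff hij.symm hj hi fun hzj => ?_)
    exact hij (hy.eq_of_ne (by rw [hzi]; exact hi.symm) (by rw [hzj]; exact hj.symm))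
  · exact Or.inl (hoff hij hi hj hzi)

/-- In all but the smallest cubes, a point has two neighbours off any given axis. -/
theorem exists_two_visible_off_axis (hd : 2 ≤ d) (hn : 2 ≤ n) (hω : 2 < ω)
    (hm : 4 ≤ d * (min n ω - 1)) (u : Fin d → Fin n) (i : Fin d) :
    ∃ p ∈ visible ω u, ∃ q ∈ visible ω u, p ≠ q ∧ (∃ j ≠ i, p j ≠ u j) ∧ ∃ j ≠ i, q j ≠ u j := by
  have hex : ∀ j ≠ i, ∀ t ≠ u j, |((u j : ℕ) : ℤ) - ((t : ℕ) : ℤ)| < (ω : ℤ) →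
      Function.update u j t ∈ visible ω u ∧ ∃ k ≠ i, Function.update u j t k ≠ u k :=
    fun j hj t ht h => ⟨mem_visible.2 (inSight_update ht h), j, hj, by simpa using ht⟩
  obtain ⟨j, hj⟩ : ∃ j, j ∉ ({i} : Finset (Fin d)) := by
    by_contra! hall
    have := Finset.card_le_card (fun j _ => hall j : Finset.univ ⊆ ({i} : Finset (Fin d)))
    simp only [Finset.card_univ, Fintype.card_fin, Finset.card_singleton] at this
    omega
  rw [Finset.mem_singleton] at hj
  obtain ⟨w, hw, hwm, hnear⟩ := exists_window (ω := ω) (u j)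
  rcases Nat.lt_or_ge 1 (min n ω - 1) with h1 | h1
  · obtain ⟨t, ht, t', ht', hne⟩ := Finset.one_lt_card.1 (h1.trans_le hwm)
    obtain ⟨h2, h3⟩ := hex j hj t (fun e => hw (e ▸ ht)) (hnear t ht)
    obtain ⟨h4, h5⟩ := hex j hj t' (fun e => hw (e ▸ ht')) (hnear t' ht')
    refine ⟨_, h2, _, h4, fun e => hne ?_, h3, h5⟩
    simpa using congrFun e j
  · obtain ⟨k, hk⟩ : ∃ k, k ∉ ({i, j} : Finset (Fin d)) := by
      by_contra! hall
      have h2 := Finset.card_le_card (fun k _ => hall k : Finset.univ ⊆ ({i, j} : Finset (Fin d)))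
      have h3 := Finset.card_le_two (a := i) (b := j)
      have h4 : d * (min n ω - 1) ≤ d * 1 := Nat.mul_le_mul_left _ h1
      simp only [Finset.card_univ, Fintype.card_fin] at h2
      omega
    simp only [Finset.mem_insert, Finset.mem_singleton, not_or] at hk
    obtain ⟨w', hw', hwm', hnear'⟩ := exists_window (ω := ω) (u k)
    obtain ⟨t, ht⟩ := Finset.card_pos.1 (by omega : 0 < w.card)
    obtain ⟨t', ht'⟩ := Finset.card_pos.1 (by omega : 0 < w'.card)
    obtain ⟨h2, h3⟩ := hex j hj t (fun e => hw (e ▸ ht)) (hnear t ht)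
    obtain ⟨h4, h5⟩ := hex k hk.1 t' (fun e => hw' (e ▸ ht')) (hnear' t' ht')
    refine ⟨_, h2, _, h4, fun e => hw (?_ : u j ∈ w), h3, h5⟩
    have := congrFun e j
    rw [Function.update_self, Function.update_of_ne (Ne.symm hk.2)] at this
    exact this ▸ ht

theorem IsCanonicalPlacement.two_le (hω : 2 < ω) (hd : 0 < d) {S T : Finset (Fin d → Fin n)}
    (h : IsCanonicalPlacement n d ω S T) : 2 ≤ d := by
  obtain ⟨-, hS, -, hS0, -⟩ := h
  by_contra! hd1
  obtain rfl : d = 1 := by omega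
  have : S.card ≤ 1 := Finset.card_le_one.2 fun a ha b hb => by
    obtain ⟨i, hi⟩ := hS0 a ha
    obtain ⟨j, hj⟩ := hS0 b hb
    funext k
    rw [Subsingleton.elim i k] at hi
    rw [Subsingleton.elim j k] at hj
    exact Fin.ext (hi.trans hj.symm)
  omega

/-- The number of monitors in a canonical placement rules out the smallest cubes. -/
theorem IsCanonicalPlacement.four_le (hn : 2 ≤ n) (hω : 2 < ω) (hd : 2 ≤ d)
    {S T : Finset (Fin d → Fin n)} (h : IsCanonicalPlacement n d ω S T) :
    4 ≤ d * (min n ω - 1) := by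
  obtain ⟨⟨-, -, hdisj⟩, hS, hT, -, -⟩ := h
  by_contra! hlt
  have h1 := Finset.card_le_univ (S ∪ T)
  rw [Finset.card_union_of_disjoint hdisj] at h1
  simp only [Fintype.card_pi, Fintype.card_fin, Finset.prod_const, Finset.card_univ] at h1
  have h2 : min n ω - 1 < 2 := by
    by_contra! h2
    have := Nat.mul_le_mul hd h2
    omega
  obtain rfl : n = 2 := by omega
  have h3 : min 2 ω - 1 = 1 := by omega
  rw [h3] at hlt
  have hd3 : d = 2 ∨ d = 3 := by omega
  rcases hd3 with rfl | rfl <;> omega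

theorem le_maxIdentifiability_of_isCanonicalPlacement (hd : 0 < d) (hn : 2 ≤ n) (hω : 2 < ω)
    {S T : Finset (Fin d → Fin n)} (h : IsCanonicalPlacement n d ω S T) :
    vertexConnectivity (hypergrid n d ω) ≤ maxIdentifiability (hypergrid n d ω) S T + 1 := by
  have hd2 := h.two_le hω hd
  have hm4 := h.four_le hn hω hd2
  obtain ⟨⟨hSne, hTne, hdisj⟩, hS, hT, -, -⟩ := h
  have hκ := vertexConnectivity_hypergrid (d := d) hn hω
  have hm : d * (min n ω - 1) + d ≤ d * ω := by
    rw [← Nat.mul_succ]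
    exact Nat.mul_le_mul_left _ (by omega)
  suffices hk : d * (min n ω - 1) - 1 ≤ maxIdentifiability (hypergrid n d ω) S T by omega
  refine le_maxIdentifiability ?_ ?_
  · have := le_ncard_usedVertices (G := hypergrid n d ω) (by omega) hSne hTne
    omega
  intro U W _ _ hne hU hW
  by_contra hsep
  have hsep' : ¬ Separable (hypergrid n d ω) S T W U := fun h => hsep (separable_comm.1 h)
  have hUW : ∀ w ∈ W, w ∉ U → U ⊆ visible ω w ∧ (visible ω w).card = d * (min n ω - 1) ∧
      U.card + 1 = d * (min n ω - 1) := fun w hw hwU =>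
    (separable_or_eq_visible hd2 hn hω hdisj hS hT (by omega) hw hwU).resolve_left hsep
  have hWU : ∀ u ∈ U, u ∉ W → W ⊆ visible ω u ∧ (visible ω u).card = d * (min n ω - 1) ∧
      W.card + 1 = d * (min n ω - 1) := fun u hu huW =>
    (separable_or_eq_visible hd2 hn hω hdisj hS hT (by omega) hu huW).resolve_left hsep'
  obtain ⟨⟨w, hw, hwU⟩, u, hu, huW⟩ : (∃ w ∈ W, w ∉ U) ∧ ∃ u ∈ U, u ∉ W := by
    by_cases h1 : ∃ w ∈ W, w ∉ U
    · refine ⟨h1, ?_⟩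
      obtain ⟨w, hw, hwU⟩ := h1
      by_contra! h2
      have h3 := (hUW w hw hwU).2.2
      exact hne (Finset.eq_of_subset_of_card_le h2 (by omega))
    · push Not at h1
      have h2 : ∃ u ∈ U, u ∉ W := by
        by_contra! h2
        exact hne (Finset.Subset.antisymm h2 h1)
      obtain ⟨u, hu, huW⟩ := h2
      have h3 := (hWU u hu huW).2.2
      exact absurd (Finset.eq_of_subset_of_card_le h1 (by omega)).symm hne
  obtain ⟨hUw, -, hUc⟩ := hUW w hw hwU
  obtain ⟨hWu, hvu, hWc⟩ := hWU u hu huW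
  obtain ⟨i, hi, -, hueq⟩ := (mem_visible.1 (hUw hu)).eq_update
  -- Some element `p` of `W` lies off the line through `u` and `w`, hence is not visible from `w`.
  obtain ⟨p, hpW, j, hji, hpj⟩ : ∃ p ∈ W, ∃ j ≠ i, p j ≠ u j := by
    obtain ⟨p, hp, q, hq, hpq, hp', hq'⟩ := exists_two_visible_off_axis hd2 hn hω hm4 u i
    by_cases hpW : p ∈ W
    · exact ⟨p, hpW, hp'⟩
    by_cases hqW : q ∈ W
    · exact ⟨q, hqW, hq'⟩
    have h1 : (insert p (insert q W)).card = W.card + 2 := by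
      rw [Finset.card_insert_of_notMem (by simp [hpq, hpW]), Finset.card_insert_of_notMem hqW]
    have h2 : insert p (insert q W) ⊆ visible ω u :=
      Finset.insert_subset hp (Finset.insert_subset hq hWu)
    have := Finset.card_le_card h2
    omega
  have hpu := mem_visible.1 (hWu hpW)
  have hwj : w j = u j := by
    rw [hueq, Function.update_of_ne hji]
  have hpi : u i = p i := by
    by_contra hne
    exact hji (hpu.eq_of_ne (Ne.symm hpj) hne)
  have hwpi : w i ≠ p i := by rw [← hpi]; exact hi.symm
  have hwpj : w j ≠ p j := by rw [hwj]; exact hpj.symm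
  have hpU : p ∉ U := fun hpU => hji ((mem_visible.1 (hUw hpU)).eq_of_ne hwpj hwpi)
  have hUp := (hUW p hpW hpU).1
  have hU2 : U ⊆ {Function.update w i (p i), Function.update w j (p j)} := by
    intro z hz
    rw [Finset.mem_insert, Finset.mem_singleton]
    exact eq_or_eq_of_inSight hji.symm hwpi hwpj (mem_visible.1 (hUw hz)) (mem_visible.1 (hUp hz))
  have := (Finset.card_le_card hU2).trans Finset.card_le_two
  omega

theorem two_mul_mul_pred_le_pow (hd : 2 ≤ d) (hn : 2 ≤ n) : 2 * (d * (n - 1)) ≤ n ^ d := by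
  obtain ⟨k, rfl⟩ : ∃ k, n = k + 2 := ⟨n - 2, by omega⟩
  rw [show k + 2 - 1 = k + 1 by omega]
  induction d, hd using Nat.le_induction with
  | base => nlinarith
  | succ d hd ih =>
    rw [pow_succ]
    have h1 : 1 * (k + 1) ≤ d * (k + 1) := Nat.mul_le_mul_right _ (by omega)
    nlinarith [Nat.zero_le (d * (k + 1) * k)]

theorem exists_placement_hypergrid (hd : 0 < d) (hn : 2 ≤ n) (hω : 2 < ω)
    (h : 2 ≤ d ∨ 2 * ω ≤ n + 3) : ∃ S T : Finset (Fin d → Fin n), IsMonitorPlacement S T ∧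
      vertexConnectivity (hypergrid n d ω) ≤ maxIdentifiability (hypergrid n d ω) S T + 1 ∧
      maxIdentifiability (hypergrid n d ω) S T ≤ vertexConnectivity (hypergrid n d ω) := by
  have hκ := vertexConnectivity_hypergrid (d := d) hn hω
  have hκ1 : 1 * 1 ≤ d * (min n ω - 1) := Nat.mul_le_mul hd (by omega)
  have hcard : Fintype.card (Fin d → Fin n) = n ^ d := by simp
  have hle : 2 * (d * (min n ω - 1)) ≤ n ^ d + 1 ∧ 2 ≤ n ^ d := by
    rcases Nat.lt_or_ge d 2 with h1 | h1
    · obtain rfl : d = 1 := by omega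
      rw [pow_one]
      omega
    · have h2 := two_mul_mul_pred_le_pow h1 hn
      have h3 : d * (min n ω - 1) ≤ d * (n - 1) := Nat.mul_le_mul_left _ (by omega)
      omega
  obtain ⟨S, -, hS⟩ := Finset.exists_subset_card_eq
    (s := (Finset.univ : Finset (Fin d → Fin n))) (n := d * (min n ω - 1))
    (by rw [Finset.card_univ, hcard]; omega)
  have hT := Finset.card_add_card_compl S
  rw [hcard] at hT
  have hST : IsMonitorPlacement S Sᶜ :=
    ⟨Finset.card_pos.1 (by omega), Finset.card_pos.1 (by omega), disjoint_compl_right⟩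
  refine ⟨S, Sᶜ, hST, ?_, maxIdentifiability_hypergrid_le hd hn hω hST⟩
  exact vertexConnectivity_le_maxIdentifiability_add_one
    (fun v => by rw [Finset.mem_compl]; exact em _) hST.1 hST.2.1 (by omega) (by omega)

end Monitors

theorem vertexConnectivity_le_of_isLoSNetwork {V : Type*} [Fintype V] {G : SimpleGraph V}
    {n d ω : ℕ} (hω : 0 < ω) [Nonempty V] (h : IsLoSNetwork G n d ω) :
    vertexConnectivity G ≤ 2 * d * (ω - 1) := by
  classical
  obtain ⟨f, hf, hadj⟩ := h
  obtain ⟨v⟩ := ‹Nonempty V›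
  refine (vertexConnectivity_le_card_of_neighbors v (Finset.univ.filter (G.Adj v))
    (by simp)).trans ?_
  have h1 := card_inSight_le (ω := ω) (f v) (2 * (ω - 1)) fun i => card_near_le hω (f v i)
  refine (Finset.card_le_card_of_injOn f (fun u hu => ?_) hf.injOn).trans
    (h1.trans_eq (by ring))
  exact Finset.mem_filter.2 ⟨Finset.mem_univ _, (hadj v u).1 (Finset.mem_filter.1 hu).2⟩

end Tomography


open Tomography in
theorem theorem1 (d ω : ℕ) (hd : 0 < d) (hω : 0 < ω) :
    (∀ n : ℕ, 2 ≤ n → 2 < ω →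
      (∀ S T : Finset (Fin d → Fin n), IsMonitorPlacement S T →
        maxIdentifiability (hypergrid n d ω) S T ≤ vertexConnectivity (hypergrid n d ω)) ∧
      (∀ S T : Finset (Fin d → Fin n), IsCanonicalPlacement n d ω S T →
        vertexConnectivity (hypergrid n d ω) ≤ maxIdentifiability (hypergrid n d ω) S T + 1) ∧
      (2 ≤ d ∨ 2 * ω ≤ n + 3 →
        ∃ S T : Finset (Fin d → Fin n), IsMonitorPlacement S T ∧
          vertexConnectivity (hypergrid n d ω) ≤
            maxIdentifiability (hypergrid n d ω) S T + 1 ∧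
          maxIdentifiability (hypergrid n d ω) S T ≤ vertexConnectivity (hypergrid n d ω))) ∧
    (∀ (V : Type*) [Fintype V] (G : SimpleGraph V) (n : ℕ), 2 ≤ Fintype.card V →
      IsLoSNetwork G n d ω →
      vertexConnectivity G ≤ 2 * d * (ω - 1) ∧
      (3 * vertexConnectivity G ≤ Fintype.card V →
        ∃ S T : Finset V, IsMonitorPlacement S T ∧
          vertexConnectivity G ≤ maxIdentifiability G S T + 2 ∧
          maxIdentifiability G S T ≤ vertexConnectivity G)) := by
  refine ⟨fun n hn hω2 => ⟨fun S T hST => maxIdentifiability_hypergrid_le hd hn hω2 hST,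
    fun S T hST => le_maxIdentifiability_of_isCanonicalPlacement hd hn hω2 hST,
    exists_placement_hypergrid hd hn hω2⟩, fun V _ G n hV hG => ⟨?_, fun h3 => ?_⟩⟩
  · have : Nonempty V := Fintype.card_pos_iff.1 (by omega)
    exact vertexConnectivity_le_of_isLoSNetwork hω hG
  · obtain ⟨S, T, hST, h1, h2⟩ := exists_placement_of_three_mul_le G hV h3
    exact ⟨S, T, hST, by omega, h2⟩
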